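/- For nonnegative integers $j,n$ let $\vartheta_2(j,n)$ be the number of $t\in\{0,\dots,n\}$ with $\nu_2\binom nt=j$, where $\nu_2$ is the $2$-adic valuation. Let $W$ be the set of (admissible) binary words $w=w_{\mu-1}\cdots w_0$ with $\mu\ge 2$, $w_{\mu-1}=1$, $w_0=0$. For $n=\sum_{i\ge0}n_i2^i$ with $n_i\in\{0,1\}$ and $w\in W$ let $|n|_w=\#\{i\ge 0: n_{i+\mu-1}\cdots n_i=w_{\mu-1}\cdots w_0\}$. For each $j\ge 0$ there is exactly one polynomial $P_j$ with rational coefficients in the variables $X_w$ ($w\in W$) such that $\vartheta_2(j,n)/\vartheta_2(0,n)=P_j\bigl((|n|_w)_{w\in W}\bigr)$ for all $n\ge0$. For a word $v$ that is empty or has leftmost letter $1$, let $n$ be the integer with binary expansion $v$ ($n=0$ for the empty word) and put $\overline T_v(x)=\frac1{\vartheta_2(0,n)}\sum_{0\le t\le n}x^{\nu_2\binom nt}$. Let $v_R$ be $v$ with its rightmost letter deleted, and let $v_L$ be $v$ with its leftmost letter and all zeros directly following it deleted (both empty if $v$ is empty). Let $v_{LR}=(v_L)_R$. For $w\in W$ put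 $$r_w(x)=\frac{\overline T_w(x)\,\overline T_{w_{LR}}(x)}{\overline T_{w_R}(x)\,\overline T_{w_L}(x)}.$$ Let $w\in W$ and let $c_j$ be the coefficient of the monomial $X_w$ in $P_j$. Then $r_w$ can be written as $$r_w(x)=(1-\xi_0x)^{\varepsilon_0}\cdots(1-\xi_{L-1}x)^{\varepsilon_{L-1}}$$ with $L\ge1$, pairwise different nonzero $\xi_i\in\mathbb C$, nonzero $\varepsilon_i\in\mathbb Z$ and $|\xi_0|\ge\cdots\ge|\xi_{L-1}|$, and for every such factorization the following holds. (a) If $|\xi_0|\le1$, then the sequence $(c_j)_{j\ge 0}$ converges (to $0$), $r_w(1)>0$, and the series $\sum_{j\ge0}c_j$ converges (possibly only conditionally), with $$\lim_{N\to\infty}\sum_{0\le j<N}c_j=\log r_w(1).$$ (b) If $|\xi_0|>1$, then the sequence $(c_j)_{j\ge 0}$ diverges (it has no limit in $\mathbb R$). If moreover $1/\xi_0$ is the only dominant singularity, i.e. $|\xi_i|<|\xi_0|$ for all $i\ne0$, then $\xi_0$ is a real number in $(-\infty,-1]$, and $c_j\sim-\varepsilon_0\,\xi_0^{\,j}/j$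 as $j\to\infty$. -/

import Mathlib

open Filter Topology Asymptotics

namespace PascalTwo

/-- A binary word `w_{μ-1} ⋯ w_0`, listed from the leftmost (most significant) letter to the
rightmost one; `true` is the digit `1` and `false` is the digit `0`. -/
abbrev Word : Type := List Bool

/-- The integer `(w)₂` represented by a binary word. -/
def wordValue (w : Word) : ℕ := w.foldl (fun n b => 2 * n + b.toNat) 0

/-- Admissible words: length at least two, leftmost letter `1`, rightmost letter `0`. -/
def Admissible (w : Word) : Prop :=
  2 ≤ w.length ∧ w.head? = some true ∧ w.getLast? = some false

/-- The set `W` of admissible words, as a type (it indexes the variables `X_w`). -/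
abbrev AdmissibleWord : Type := {w : Word // Admissible w}

/-- `|n|_w`: the number of positions `i ≥ 0` such that
`n_{i+μ-1} ⋯ n_i = w_{μ-1} ⋯ w_0`, where `n_k` is the `k`-th binary digit of `n`
(so the expansion is padded with zeros) and `μ` is the length of `w`.
The letter `w[k]` of the list stands at place `μ - 1 - k`. -/
noncomputable def factorCount (n : ℕ) (w : Word) : ℕ :=
  Set.ncard {i : ℕ | ∀ (k : ℕ) (hk : k < w.length),
    n.testBit (i + (w.length - 1 - k)) = w[k]}

/-- `ϑ₂(j, n)`: the number of `t ∈ {0, …, n}` such that `2 ^ j` divides `n.choose t` exactly. -/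
def theta (j n : ℕ) : ℕ :=
  ((Finset.range (n + 1)).filter (fun t => padicValNat 2 (n.choose t) = j)).card

/-- `P` is a polynomial in the variables `X_w`, `w ∈ W`, that represents
`ϑ₂(j, n) / ϑ₂(0, n)` for all `n ≥ 0` when each `X_w` is set to `|n|_w`. -/
def Represents (j : ℕ) (P : MvPolynomial AdmissibleWord ℚ) : Prop :=
  ∀ n : ℕ, MvPolynomial.eval (fun w : AdmissibleWord => (factorCount n w.1 : ℚ)) P
    = (theta j n : ℚ) / (theta 0 n : ℚ)

/-- `T_n(x) = ∑_{0 ≤ t ≤ n} x ^ ν₂(n.choose t)`. -/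
noncomputable def T (K : Type*) [Field K] (n : ℕ) : Polynomial K :=
  ∑ t ∈ Finset.range (n + 1), Polynomial.X ^ padicValNat 2 (n.choose t)

/-- The normalized polynomial `T_v(x) / ϑ₂(0, n)` of a word `v`, where `n = (v)₂`. -/
noncomputable def Tbar (K : Type*) [Field K] (v : Word) : Polynomial K :=
  Polynomial.C ((theta 0 (wordValue v) : K)⁻¹) * T K (wordValue v)

/-- Left truncation `w_L`: delete the leftmost letter and all zeros that follow it. -/
def truncL (w : Word) : Word := w.tail.dropWhile (fun b => !b)

/-- Right truncation `w_R`: delete the rightmost letter. -/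
def truncR (w : Word) : Word := w.dropLast

/-- The rational function `r_w = (T̄_w T̄_{w_LR}) / (T̄_{w_R} T̄_{w_L})`. -/
noncomputable def r (K : Type*) [Field K] (w : Word) : RatFunc K :=
  algebraMap (Polynomial K) (RatFunc K) (Tbar K w * Tbar K (truncR (truncL w))) /
    algebraMap (Polynomial K) (RatFunc K) (Tbar K (truncR w) * Tbar K (truncL w))

/-- `r_w(x) = ∏_{i < L} (1 - ξ_i x) ^ ε_i` with pairwise different nonzero `ξ_i ∈ ℂ`, nonzero
`ε_i ∈ ℤ` and `|ξ_0| ≥ ⋯ ≥ |ξ_{L-1}|`. -/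
structure IsFactorization (w : Word) {L : ℕ} (ξ : Fin L → ℂ) (ε : Fin L → ℤ) : Prop where
  injective : Function.Injective ξ
  base_ne_zero : ∀ i, ξ i ≠ 0
  exponent_ne_zero : ∀ i, ε i ≠ 0
  antitone_norm : Antitone (fun i => ‖ξ i‖)
  eq_prod : r ℂ w = ∏ i, (1 - RatFunc.C (ξ i) * RatFunc.X) ^ (ε i)

/-- The coefficient of the monomial `X_w` in `P`, as a real number. -/
noncomputable def coeffX (w : AdmissibleWord) (P : MvPolynomial AdmissibleWord ℚ) : ℝ :=
  ((MvPolynomial.coeff (Finsupp.single w 1) P : ℚ) : ℝ)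

end PascalTwo

namespace PascalTwo

/-! ### Recurrences for the row polynomials -/

/-! Write `T̄` for the normalized row polynomial `normT`. Its constant term is 1, and appending a
digit 1 to `n` does not change it (`normT_odd`). Any function `D` on integers with this invariance
satisfies `D n - D 0 = ∑_w |n|_w (D w - D w_R - D w_L + D w_LR)`, by telescoping over the last digit
and over the leading blocks (`sum_factorCount`). Applied to the coefficients of `T̄'/T̄`, this is
the formal product `T̄_n = ∏_w r_w ^ |n|_w`.

The product makes sense coefficientwise. `T` and its companion `U` obey a 2×2 linear recurrence in
the digits of `n` whose matrices have determinant `2x`, so the numerator and denominator of `r_w`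
differ by a nonzero multiple of `x^(μ-1)`, `μ` being the length of `w` (`det_U_T`, `normT_det`).
Hence only finitely many words influence a given coefficient. Exponentiating gives polynomials `P_j`
(`quotientPoly_represents`), and the coefficient of `X_w` in `P_j` is `[x^j] log r_w`
(`coeff_single_quotientPoly_succ`). Uniqueness of `P_j` is the algebraic independence of the factor
counts (`eq_zero_of_eval_factorCount`).

A factorization of `r_w` turns this into `c_j = -(1/j) ∑ ε_i ξ_i^j` (`IsFactorization.coeffX_eq`).
The row polynomials are positive on the positive axis, so no `ξ_i` is a positive real
(`IsFactorization.mul_ne_one`). If all `|ξ_i| ≤ 1`, then `ξ_i ≠ 1` and the logarithm series converge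
to their Abel limits (`tendsto_sum_pow_div`, `tendsto_sum_log`). If `|ξ_0| > 1`, a power sum with
distinct bases cannot be small compared with `ξ_0^j` (`not_tendsto_powerSum`). If `ξ_0` is strictly
dominant, the fact that the `c_j` are real forces `ξ_0` to be real (`exists_real_isEquivalent`). -/

theorem digits_sum_two_mul (n : ℕ) : (Nat.digits 2 (2 * n)).sum = (Nat.digits 2 n).sum := by
  rcases Nat.eq_zero_or_pos n with rfl | h
  · simp
  · rw [Nat.digits_base_mul (by norm_num) h]; simp

/-- By Legendre's formula the valuation depends only on the digit sums of `n`, `t` and `n - t`, and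
doubling changes none of them. -/
theorem padicValNat_choose_two_mul (n t : ℕ) (h : t ≤ n) :
    padicValNat 2 ((2 * n).choose (2 * t)) = padicValNat 2 (n.choose t) := by
  have h1 := sub_one_mul_padicValNat_choose_eq_sub_sum_digits (p := 2) h
  have h2 := sub_one_mul_padicValNat_choose_eq_sub_sum_digits (p := 2) (k := 2 * t) (n := 2 * n)
    (by omega)
  rw [← Nat.mul_sub, digits_sum_two_mul, digits_sum_two_mul, digits_sum_two_mul] at h2
  simpa using h2.trans h1.symm

theorem padicValNat_two_odd (n : ℕ) : padicValNat 2 (2 * n + 1) = 0 :=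
  padicValNat.eq_zero_of_not_dvd (by omega)

theorem padicValNat_choose_odd_row_odd (n t : ℕ) (h : t ≤ n) :
    padicValNat 2 ((2 * n + 1).choose (2 * t + 1)) = padicValNat 2 (n.choose t) := by
  have h1 := Nat.add_one_mul_choose_eq (2 * n) (2 * t)
  have h2 := congrArg (padicValNat 2) h1
  rw [padicValNat.mul (by omega) (Nat.choose_pos (by omega)).ne',
    padicValNat.mul (Nat.choose_pos (by omega)).ne' (by omega), padicValNat_two_odd, padicValNat_two_odd,
    padicValNat_choose_two_mul n t h] at h2
  omega

theorem padicValNat_choose_odd_row_even (n t : ℕ) (h : t ≤ n) :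
    padicValNat 2 ((2 * n + 1).choose (2 * t)) = padicValNat 2 (n.choose t) := by
  rw [← Nat.choose_symm (by omega), show 2 * n + 1 - 2 * t = 2 * (n - t) + 1 by omega,
    padicValNat_choose_odd_row_odd n _ (by omega), Nat.choose_symm h]

/-- The absorption identity relates the entry to row `2n + 1`; its factors are `2(n + 1)` and an odd
number, which account for the extra `1 + ν₂(n + 1)`. -/
theorem padicValNat_choose_even_row_odd (n t : ℕ) (h : t ≤ n) :
    padicValNat 2 ((2 * (n + 1)).choose (2 * t + 1))
      = 1 + padicValNat 2 (n + 1) + padicValNat 2 (n.choose t) := by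
  have h1 := Nat.add_one_mul_choose_eq (2 * n + 1) (2 * t)
  have h2 := congrArg (padicValNat 2) h1
  rw [padicValNat.mul (by omega) (Nat.choose_pos (by omega)).ne',
    padicValNat.mul (Nat.choose_pos (by omega)).ne' (by omega), padicValNat_two_odd, padicValNat_choose_odd_row_even n t h,
    show 2 * n + 1 + 1 = 2 * (n + 1) by ring, padicValNat.mul (by omega) (by omega),
    padicValNat.self (by norm_num)] at h2
  omega

theorem sum_range_two_mul {M : Type*} [AddCommMonoid M] (f : ℕ → M) (n : ℕ) :
    ∑ t ∈ Finset.range (2 * n), f t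
      = ∑ t ∈ Finset.range n, f (2 * t) + ∑ t ∈ Finset.range n, f (2 * t + 1) := by
  induction n with
  | zero => simp
  | succ n ih =>
    rw [show 2 * (n + 1) = 2 * n + 1 + 1 by ring, Finset.sum_range_succ, Finset.sum_range_succ, ih,
      Finset.sum_range_succ, Finset.sum_range_succ]
    abel

section Recurrences

variable (K : Type*) [Field K]

/-- The companion of `T K n` in the linear recurrence over the binary digits of `n`. -/
noncomputable def U (n : ℕ) : Polynomial K :=
  ∑ t ∈ Finset.range n,
    Polynomial.X ^ (padicValNat 2 n + padicValNat 2 ((n - 1).choose t))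

theorem U_succ (n : ℕ) : U K (n + 1) = Polynomial.X ^ padicValNat 2 (n + 1) * T K n := by
  simp [U, T, Finset.mul_sum, pow_add]

theorem U_zero : U K 0 = 0 := by simp [U]

theorem T_zero : T K 0 = 1 := by simp [T]

theorem T_odd (n : ℕ) : T K (2 * n + 1) = 2 * T K n := by
  unfold T
  rw [show 2 * n + 1 + 1 = 2 * (n + 1) by ring, sum_range_two_mul]
  have h1 : ∀ t ∈ Finset.range (n + 1),
      (Polynomial.X : Polynomial K) ^ padicValNat 2 ((2 * n + 1).choose (2 * t))
        = Polynomial.X ^ padicValNat 2 (n.choose t) := fun t ht => by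
    rw [padicValNat_choose_odd_row_even n t (by simpa [Nat.lt_succ_iff] using ht)]
  have h2 : ∀ t ∈ Finset.range (n + 1),
      (Polynomial.X : Polynomial K) ^ padicValNat 2 ((2 * n + 1).choose (2 * t + 1))
        = Polynomial.X ^ padicValNat 2 (n.choose t) := fun t ht => by
    rw [padicValNat_choose_odd_row_odd n t (by simpa [Nat.lt_succ_iff] using ht)]
  rw [Finset.sum_congr rfl h1, Finset.sum_congr rfl h2, ← two_mul]

/-- Entries in even positions of row `2n` reproduce row `n`; those in odd positions come from row `n
- 1`, with the valuation shift that `U` records. -/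
theorem T_even (n : ℕ) : T K (2 * n) = T K n + Polynomial.X * U K n := by
  rcases n with _ | n
  · simp [U_zero]
  unfold T U
  have h1 : ∀ t ∈ Finset.range (n + 1),
      (Polynomial.X : Polynomial K) ^ padicValNat 2 ((2 * (n + 1)).choose (2 * t))
        = Polynomial.X ^ padicValNat 2 ((n + 1).choose t) := fun t ht => by
    rw [padicValNat_choose_two_mul _ t (Finset.mem_range.1 ht).le]
  have h2 : ∀ t ∈ Finset.range (n + 1),
      (Polynomial.X : Polynomial K) ^ padicValNat 2 ((2 * (n + 1)).choose (2 * t + 1))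
        = Polynomial.X * Polynomial.X ^ (padicValNat 2 (n + 1) +
          padicValNat 2 ((n + 1 - 1).choose t)) := fun t ht => by
    rw [padicValNat_choose_even_row_odd n t (by simpa [Nat.lt_succ_iff] using ht)]
    simp only [Nat.add_sub_cancel]
    ring
  rw [Finset.sum_range_succ, sum_range_two_mul, Finset.sum_range_succ _ (n + 1),
    Finset.sum_congr rfl h1, Finset.sum_congr rfl h2, Finset.mul_sum]
  simp only [Nat.choose_self]
  ring

theorem U_odd (n : ℕ) : U K (2 * n + 1) = T K n + Polynomial.X * U K n := by
  rw [U_succ, padicValNat_two_odd, pow_zero, one_mul, T_even]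

theorem U_even (n : ℕ) : U K (2 * n) = 2 * Polynomial.X * U K n := by
  rcases n with _ | n
  · simp [U_zero]
  rw [show 2 * (n + 1) = 2 * n + 1 + 1 by ring, U_succ, T_odd, U_succ,
    show 2 * n + 1 + 1 = 2 * (n + 1) by ring, padicValNat.mul (by omega) (by omega),
    padicValNat.self (by norm_num), pow_add, pow_one]
  ring

theorem coeff_T (n j : ℕ) : (T K n).coeff j = theta j n := by
  simp only [T, Polynomial.finsetSum_coeff, Polynomial.coeff_X_pow, theta]
  rw [Finset.card_filter]
  push_cast
  exact Finset.sum_congr rfl fun t _ => by simp [eq_comm]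

theorem theta_zero_pos (n : ℕ) : 0 < theta 0 n := by
  rw [theta, Finset.card_pos]
  exact ⟨0, by simp⟩

theorem theta_zero_even (n : ℕ) : theta 0 (2 * n) = theta 0 n := by
  have h := congrArg (Polynomial.coeff · 0) (T_even ℚ n)
  simp only [coeff_T, Polynomial.coeff_add, Polynomial.coeff_X_mul_zero, add_zero] at h
  exact_mod_cast h

/-- The word with its leading one removed, as an operation on integers. -/
def dropTop (n : ℕ) : ℕ := n - 2 ^ Nat.log 2 n

theorem dropTop_lt {n : ℕ} (h : n ≠ 0) : dropTop n < n :=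
  Nat.sub_lt (Nat.pos_of_ne_zero h) (by positivity)

theorem log_two_bit (n b : ℕ) (h : n ≠ 0) (hb : b < 2) :
    Nat.log 2 (2 * n + b) = Nat.log 2 n + 1 := by
  rw [Nat.log_of_one_lt_of_le (by norm_num) (by omega), show (2 * n + b) / 2 = n by omega]

theorem dropTop_bit (n b : ℕ) (h : n ≠ 0) (hb : b < 2) :
    dropTop (2 * n + b) = 2 * dropTop n + b := by
  have := Nat.pow_log_le_self 2 h
  rw [dropTop, log_two_bit n b h hb, pow_succ, dropTop]
  omega

/-- For `n ≥ 2`, `n` and `dropTop n` have the same last digit, so the pairs `(T, U)` at both undergo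
the same linear map when it is appended. That map has determinant `2x` for either digit. The base
case `n = 1` has determinant 1. -/
theorem det_U_T (n : ℕ) (h : n ≠ 0) :
    U K n * T K (dropTop n) - T K n * U K (dropTop n) = (2 * Polynomial.X) ^ Nat.log 2 n := by
  induction n using Nat.strong_induction_on with
  | _ n ih =>
    obtain ⟨m, b, hb, rfl⟩ : ∃ m b, b < 2 ∧ n = 2 * m + b :=
      ⟨n / 2, n % 2, Nat.mod_lt _ (by norm_num), by omega⟩
    rcases Nat.eq_zero_or_pos m with rfl | hm
    · obtain rfl : b = 1 := by omega
      have h1 := U_odd K 0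
      have h2 := T_odd K 0
      simp only [mul_zero, zero_add, U_zero, T_zero, add_zero] at h1 h2
      simp [dropTop, T_zero, U_zero, h1]
    · have ih := ih m (by omega) hm.ne'
      rw [dropTop_bit m b hm.ne' hb, log_two_bit m b hm.ne' hb, pow_succ, ← ih]
      interval_cases b
      · simp only [add_zero, T_even, U_even]; ring
      · simp only [T_odd, U_odd]; ring

/-- The normalized row polynomial. -/
noncomputable def normT (n : ℕ) : Polynomial K := Polynomial.C ((theta 0 n : K)⁻¹) * T K n

theorem Tbar_eq (v : Word) : Tbar K v = normT K (wordValue v) := rfl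

theorem coeff_normT (n j : ℕ) : (normT K n).coeff j = theta j n / theta 0 n := by
  rw [normT, Polynomial.coeff_C_mul, coeff_T, div_eq_inv_mul]

theorem normT_zero : normT K 0 = 1 := by
  rw [normT, T_zero, show theta 0 0 = 1 by simp [theta, Finset.filter_true_of_mem]]
  simp

variable [CharZero K]

theorem normT_coeff_zero (n : ℕ) : (normT K n).coeff 0 = 1 := by
  rw [coeff_normT, div_self]
  exact_mod_cast (theta_zero_pos n).ne'

/-- Appending 1 doubles `T` and hence also its constant term, so the normalization cancels the
factor. -/
theorem normT_odd (n : ℕ) : normT K (2 * n + 1) = normT K n := by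
  have h := congrArg (Polynomial.coeff · 0) (T_odd K n)
  rw [show (2 : Polynomial K) = Polynomial.C 2 from rfl] at h
  simp only [coeff_T, Polynomial.coeff_C_mul] at h
  rw [normT, normT, T_odd, h, show (2 : Polynomial K) = Polynomial.C 2 from rfl, ← mul_assoc,
    ← Polynomial.C_mul]
  congr 2
  have : (theta 0 n : K) ≠ 0 := by exact_mod_cast (theta_zero_pos n).ne'
  field_simp

/-- The numerator and the denominator of `r_w` differ by a monomial. -/
theorem normT_det (n : ℕ) (h : n ≠ 0) :
    ∃ c : K, c ≠ 0 ∧ normT K (2 * n) * normT K (dropTop n)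
      - normT K n * normT K (2 * dropTop n) = Polynomial.C c * Polynomial.X ^ (Nat.log 2 n + 1) := by
  have h1 : (theta 0 n : K) ≠ 0 := by exact_mod_cast (theta_zero_pos n).ne'
  have h2 : (theta 0 (dropTop n) : K) ≠ 0 := by exact_mod_cast (theta_zero_pos _).ne'
  refine ⟨(theta 0 n : K)⁻¹ * (theta 0 (dropTop n) : K)⁻¹ * 2 ^ Nat.log 2 n,
    mul_ne_zero (mul_ne_zero (inv_ne_zero h1) (inv_ne_zero h2)) (by simp), ?_⟩
  have h3 := det_U_T K n h
  simp only [normT, theta_zero_even, T_even, Polynomial.C_mul, Polynomial.C_pow]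
  rw [mul_pow] at h3
  rw [show (Polynomial.C (2 : K)) = 2 from rfl]
  -- Expanding `T_{2n} = T_n + x U_n` leaves `x` times the determinant; the normalizing constants
  -- agree because `ϑ₂(0, 2n) = ϑ₂(0, n)`.
  linear_combination (Polynomial.C ((theta 0 n : K)⁻¹) * Polynomial.C (theta 0 (dropTop n) : K)⁻¹
    * Polynomial.X) * h3

end Recurrences

/-! ### Words and integers -/

theorem wordValue_append (w : Word) (b : Bool) :
    wordValue (w ++ [b]) = 2 * wordValue w + b.toNat := by
  simp [wordValue, List.foldl_append]

theorem wordValue_nil : wordValue [] = 0 := rfl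

theorem wordValue_cons (b : Bool) (w : Word) :
    wordValue (b :: w) = b.toNat * 2 ^ w.length + wordValue w := by
  induction w using List.reverseRecOn with
  | nil => simp [wordValue]
  | append_singleton w c ih =>
    rw [← List.cons_append, wordValue_append, wordValue_append, ih, List.length_append]
    simp only [List.length_singleton, pow_succ]
    ring

theorem wordValue_lt (w : Word) : wordValue w < 2 ^ w.length := by
  induction w using List.reverseRecOn with
  | nil => simp [wordValue]
  | append_singleton w c ih =>
    rw [wordValue_append, List.length_append, List.length_singleton, pow_succ]
    have := Bool.toNat_lt c
    omega

theorem log_wordValue (w : Word) : Nat.log 2 (wordValue (true :: w)) = w.length := by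
  have := wordValue_lt w
  rw [wordValue_cons, Bool.toNat_true, one_mul]
  refine Nat.log_eq_of_pow_le_of_lt_pow (by omega) ?_
  rw [pow_succ]; omega

theorem wordValue_truncR (w : Word) : wordValue (truncR w) = wordValue w / 2 := by
  induction w using List.reverseRecOn with
  | nil => rfl
  | append_singleton w c ih =>
    rw [truncR, List.dropLast_concat, wordValue_append]
    have := Bool.toNat_lt c
    omega

theorem wordValue_dropWhile (w : Word) :
    wordValue (w.dropWhile (fun b => !b)) = wordValue w := by
  induction w with
  | nil => rfl
  | cons b w ih =>
    cases b
    · rw [List.dropWhile_cons_of_pos (by rfl), ih, wordValue_cons]; simp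
    · rw [List.dropWhile_cons_of_neg (by simp)]

theorem wordValue_truncL (w : Word) (h : w.head? = some true) :
    wordValue (truncL w) = dropTop (wordValue w) := by
  obtain ⟨w, rfl⟩ : ∃ u, w = true :: u := by
    rcases w with _ | ⟨b, u⟩
    · simp at h
    · exact ⟨u, by simpa using h⟩
  rw [dropTop, log_wordValue, truncL, List.tail_cons, wordValue_dropWhile, wordValue_cons]
  simp

/-! ### Suffixes and factor counts -/

/-- The word `w` is a suffix of the (zero-padded) binary expansion of `n`. -/
abbrev EndsWith (n : ℕ) (w : Word) : Prop := n % 2 ^ w.length = wordValue w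

theorem endsWith_append (n : ℕ) (w : Word) (b : Bool) :
    EndsWith n (w ++ [b]) ↔ n.testBit 0 = b ∧ EndsWith (n / 2) w := by
  unfold EndsWith
  rw [List.length_append, List.length_singleton, pow_succ, mul_comm, Nat.mod_mul, wordValue_append,
    Nat.testBit_zero]
  cases b <;> simp <;> omega

theorem endsWith_iff (n : ℕ) (w : Word) :
    EndsWith n w ↔ ∀ (k : ℕ) (hk : k < w.length), n.testBit (w.length - 1 - k) = w[k] := by
  induction w using List.reverseRecOn generalizing n with
  | nil => simp [EndsWith, wordValue_nil, Nat.mod_one]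
  | append_singleton w b ih =>
    rw [endsWith_append, ih]
    constructor
    · rintro ⟨h1, h2⟩ k hk
      rw [List.length_append, List.length_singleton] at hk ⊢
      rcases Nat.lt_succ_iff_lt_or_eq.1 hk with h | rfl
      · rw [List.getElem_append_left h, ← h2 k h,
          show w.length + 1 - 1 - k = (w.length - 1 - k) + 1 by omega, Nat.testBit_succ]
      · simpa using h1
    · intro h
      refine ⟨?_, fun k hk => ?_⟩
      · simpa using h w.length (by simp)
      · have := h k (by simp; omega)
        rw [List.getElem_append_left hk] at this
        rw [← this, List.length_append, List.length_singleton,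
          show w.length + 1 - 1 - k = (w.length - 1 - k) + 1 by omega, Nat.testBit_succ]

theorem factorCount_eq (n : ℕ) (w : Word) :
    factorCount n w = Set.ncard {i : ℕ | EndsWith (n / 2 ^ i) w} := by
  simp only [factorCount, endsWith_iff, ← Nat.shiftRight_eq_div_pow, Nat.testBit_shiftRight]

theorem Admissible.exists_eq_cons {w : Word} (h : Admissible w) :
    ∃ u : Word, w = true :: u := by
  rcases w with _ | ⟨b, u⟩
  · simp [Admissible] at h
  · exact ⟨u, by simpa using h.2.1⟩

theorem Admissible.exists_eq_append {w : Word} (h : Admissible w) :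
    ∃ u : Word, w = u ++ [false] := by
  induction w using List.reverseRecOn with
  | nil => simp [Admissible] at h
  | append_singleton u b _ => exact ⟨u, by simpa using h.2.2⟩

theorem Admissible.length_eq {w : Word} (h : Admissible w) :
    w.length = Nat.log 2 (wordValue w) + 1 := by
  obtain ⟨u, rfl⟩ := h.exists_eq_cons
  rw [log_wordValue, List.length_cons]

theorem Admissible.two_dvd {w : Word} (h : Admissible w) : 2 ∣ wordValue w := by
  obtain ⟨u, rfl⟩ := h.exists_eq_append
  rw [wordValue_append]; simp

theorem Admissible.wordValue_pos {w : Word} (h : Admissible w) : 0 < wordValue w := by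
  obtain ⟨u, rfl⟩ := h.exists_eq_cons
  rw [wordValue_cons]; simp

theorem wordValue_injective_of_length {v w : Word} (hl : v.length = w.length)
    (h : wordValue v = wordValue w) : v = w := by
  have hv : EndsWith (wordValue v) v := Nat.mod_eq_of_lt (wordValue_lt v)
  have hw : EndsWith (wordValue v) w := by
    rw [h]; exact Nat.mod_eq_of_lt (wordValue_lt w)
  rw [endsWith_iff] at hv hw
  refine List.ext_getElem hl fun k h1 h2 => ?_
  rw [← hv k h1, ← hw k h2, hl]

theorem admissible_ext {v w : AdmissibleWord} (h : wordValue v.1 = wordValue w.1) : v = w :=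
  Subtype.ext (wordValue_injective_of_length (by rw [v.2.length_eq, w.2.length_eq, h]) h)

theorem exists_word (n : ℕ) (h : n ≠ 0) :
    ∃ w : Word, w.head? = some true ∧ wordValue w = n := by
  induction n using Nat.strong_induction_on with
  | _ n ih =>
    rcases Nat.lt_or_ge n 2 with h2 | h2
    · exact ⟨[true], rfl, by simp [wordValue]; omega⟩
    · obtain ⟨w, h3, h4⟩ := ih (n / 2) (by omega) (by omega)
      refine ⟨w ++ [n.testBit 0], by simp [List.head?_append, h3], ?_⟩
      rw [wordValue_append, h4, Nat.testBit_zero]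
      rcases Nat.mod_two_eq_zero_or_one n with h | h <;> simp [h] <;> omega

theorem exists_admissible (m : ℕ) (h : m ≠ 0) :
    ∃ w : AdmissibleWord, wordValue w.1 = 2 * m := by
  obtain ⟨u, h1, h2⟩ := exists_word m h
  refine ⟨⟨u ++ [false], ?_, by simp [List.head?_append, h1], by simp⟩, ?_⟩
  · rcases u with _ | ⟨b, u⟩
    · simp at h1
    · simp
  · simp [wordValue_append, h2]

theorem finite_admissible_length_le (k : ℕ) : {w : AdmissibleWord | w.1.length ≤ k}.Finite :=
  (List.finite_length_le Bool k).preimage Subtype.val_injective.injOn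

/-- The finset of admissible words of length at most `k`. -/
noncomputable def wordsUpTo (k : ℕ) : Finset AdmissibleWord :=
  (finite_admissible_length_le k).toFinset

theorem mem_wordsUpTo {k : ℕ} {w : AdmissibleWord} : w ∈ wordsUpTo k ↔ w.1.length ≤ k := by
  simp [wordsUpTo]

theorem EndsWith.le {n : ℕ} {w : Word} (h : EndsWith n w) : wordValue w ≤ n :=
  h ▸ Nat.mod_le _ _

theorem factorCount_zero {w : Word} (h : Admissible w) : factorCount 0 w = 0 := by
  rw [factorCount_eq]
  convert Set.ncard_empty ℕ
  ext i
  have := h.wordValue_pos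
  simp [EndsWith]
  omega

theorem factorCount_succ {w : Word} (h : Admissible w) (n : ℕ) :
    factorCount n w = factorCount (n / 2) w + if EndsWith n w then 1 else 0 := by
  rw [factorCount_eq, factorCount_eq]
  -- Finiteness is needed for additivity of `Set.ncard`: an occurrence at position `i` forces `2^i ≤
  -- m`.
  have hfin : ∀ m : ℕ, {i : ℕ | EndsWith (m / 2 ^ i) w}.Finite := fun m => by
    refine (Set.finite_lt_nat m).subset fun i hi => ?_
    have h1 := h.wordValue_pos.trans_le (EndsWith.le hi)
    exact Nat.lt_two_pow_self.trans_le (Nat.div_pos_iff.1 h1).2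
  have hs : {i : ℕ | EndsWith (n / 2 ^ i) w}
      = Nat.succ '' {i : ℕ | EndsWith (n / 2 / 2 ^ i) w} ∪ {i | i = 0 ∧ EndsWith n w} := by
    ext i
    rcases i with _ | i
    · simp
    · simp [pow_succ', Nat.div_div_eq_div_mul]
  rw [hs, Set.ncard_union_eq _ ((hfin _).image _)
    ((Set.finite_singleton 0).subset fun i hi => hi.1),
    Set.ncard_image_of_injective _ Nat.succ_injective]
  · congr 1
    split_ifs with h1
    · exact Set.ncard_eq_one.2 ⟨0, by ext i; simpa using fun _ => h1⟩
    · simp [h1]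
  · rw [Set.disjoint_left]
    rintro i ⟨k, _, rfl⟩ ⟨h1, _⟩
    simp at h1

/-- Since `w` starts with 1, an occurrence of `w` at the end of `n` either begins at the leading 1
of `n`, so that `w` is all of `n`, or begins further right and survives the removal of that 1. It
cannot begin in the zero padding. -/
theorem endsWith_iff_dropTop {n : ℕ} {w : Word} (hw : Admissible w) (hn : n ≠ 0) :
    EndsWith n w ↔ wordValue w = n ∨ EndsWith (dropTop n) w := by
  obtain ⟨u, rfl⟩ := hw.exists_eq_cons
  have h1 := wordValue_lt u
  have h2 : 2 ^ Nat.log 2 n ≤ n := Nat.pow_log_le_self 2 hn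
  have h3 : n < 2 ^ Nat.log 2 n * 2 := pow_succ 2 (Nat.log 2 n) ▸ Nat.lt_pow_succ_log_self (by norm_num) n
  have h0 : n = dropTop n + 2 ^ Nat.log 2 n := by unfold dropTop; omega
  unfold EndsWith
  rw [wordValue_cons, List.length_cons, Bool.toNat_true, one_mul]
  generalize Nat.log 2 n = L at *
  generalize dropTop n = d at *
  rcases lt_trichotomy u.length L with h | h | h
  · obtain ⟨k, rfl⟩ := Nat.exists_eq_add_of_lt h
    have h4 : 2 ^ (u.length + 1) ≤ 2 ^ (u.length + k + 1) :=
      Nat.pow_le_pow_right (by norm_num) (by omega)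
    have h5 : n % 2 ^ (u.length + 1) = d % 2 ^ (u.length + 1) := by
      rw [h0, show u.length + k + 1 = u.length + 1 + k by ring, pow_add, Nat.add_mul_mod_self_left]
    rw [h5]
    rw [pow_succ] at h4
    constructor
    · exact Or.inr
    · rintro (h6 | h6)
      · omega
      · exact h6
  · subst h
    rw [pow_succ, Nat.mod_eq_of_lt h3, Nat.mod_eq_of_lt (by omega)]
    omega
  · have h4 : 2 ^ (L + 1) ≤ 2 ^ u.length := Nat.pow_le_pow_right (by norm_num) (by omega)
    rw [pow_succ] at h4
    rw [pow_succ, Nat.mod_eq_of_lt (by omega), Nat.mod_eq_of_lt (by omega)]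
    omega

/-! ### Telescoping over factors of the binary expansion -/

section Telescoping

variable {A : Type*} [AddCommGroup A]

/-- The mixed second difference of a function on integers along an admissible word. -/
def secondDiff (D : ℕ → A) (n : ℕ) : A := D n - D (n / 2) - (D (dropTop n) - D (dropTop n / 2))

/-- The admissible suffixes of an even `n > 0` are `n`, `n_L`, `n_LL`, and so on until 0 is reached.
Along this chain the second differences telescope. -/
theorem sum_endsWith (D : ℕ → A) (F : Finset AdmissibleWord)
    (hF : ∀ w : AdmissibleWord, w ∉ F → secondDiff D (wordValue w.1) = 0) (n : ℕ) (hn : 2 ∣ n) :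
    ∑ w ∈ F, (if EndsWith n w.1 then secondDiff D (wordValue w.1) else 0) = D n - D (n / 2) := by
  induction n using Nat.strong_induction_on with
  | _ n ih =>
    rcases eq_or_ne n 0 with rfl | h0
    · rw [Finset.sum_eq_zero]
      · simp
      · intro w _
        rw [if_neg]
        intro h
        have := w.2.wordValue_pos.trans_le h.le
        omega
    have hd : 2 ∣ dropTop n := by
      have h2 : Nat.log 2 n ≠ 0 := (Nat.log_pos (by norm_num) (by omega)).ne'
      exact Nat.dvd_sub hn (dvd_pow_self 2 h2)
    obtain ⟨m, rfl⟩ := hn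
    obtain ⟨v, hv⟩ := exists_admissible m (by omega)
    -- Exactly one admissible word, `v`, has value `2 * m`; every other suffix is already a suffix
    -- of `dropTop (2 * m)`.
    have key : ∀ w ∈ F, (if EndsWith (2 * m) w.1 then secondDiff D (wordValue w.1) else 0)
        = (if w = v then secondDiff D (wordValue v.1) else 0)
          + if EndsWith (dropTop (2 * m)) w.1 then secondDiff D (wordValue w.1) else 0 := by
      intro w _
      have h1 := endsWith_iff_dropTop w.2 h0
      by_cases hwv : w = v
      · subst hwv
        have h2 : ¬ EndsWith (dropTop (2 * m)) w.1 := fun h => by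
          have := h.le
          have := dropTop_lt h0
          omega
        rw [if_pos (h1.2 (Or.inl hv)), if_pos rfl, if_neg h2, add_zero]
      · have h2 : wordValue w.1 ≠ 2 * m := fun h => hwv (admissible_ext (h.trans hv.symm))
        simp [h1, h2, hwv]
    rw [Finset.sum_congr rfl key, Finset.sum_add_distrib, ih _ (dropTop_lt h0) hd,
      Finset.sum_ite_eq']
    have h3 : (if v ∈ F then secondDiff D (wordValue v.1) else 0) = secondDiff D (wordValue v.1) := by
      split_ifs with h
      · rfl
      · exact (hF v h).symm
    rw [h3, hv, secondDiff]
    abel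

/-- Deleting the last digit of `n` removes exactly the occurrences that are suffixes of `n`. For
even `n` they contribute `D n - D (n / 2)`; for odd `n` there are none, and `hD` says that nothing
is needed. -/
theorem sum_factorCount (D : ℕ → A) (hD : ∀ m, D (2 * m + 1) = D m) (F : Finset AdmissibleWord)
    (hF : ∀ w : AdmissibleWord, w ∉ F → secondDiff D (wordValue w.1) = 0) (n : ℕ) :
    ∑ w ∈ F, factorCount n w.1 • secondDiff D (wordValue w.1) = D n - D 0 := by
  induction n using Nat.strong_induction_on with
  | _ n ih =>
    rcases eq_or_ne n 0 with rfl | h0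
    · rw [sub_self]
      exact Finset.sum_eq_zero fun w _ => by rw [factorCount_zero w.2, zero_smul]
    have ih := ih (n / 2) (by omega)
    have h1 : ∀ w ∈ F, factorCount n w.1 • secondDiff D (wordValue w.1)
        = factorCount (n / 2) w.1 • secondDiff D (wordValue w.1)
          + if EndsWith n w.1 then secondDiff D (wordValue w.1) else 0 := fun w _ => by
      rw [factorCount_succ w.2 n, add_smul, ite_smul, one_smul, zero_smul]
    rw [Finset.sum_congr rfl h1, Finset.sum_add_distrib, ih]
    by_cases hn : 2 ∣ n
    · rw [sum_endsWith D F hF n hn]; abel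
    · have h2 : D n = D (n / 2) := by
        conv_lhs => rw [show n = 2 * (n / 2) + 1 by omega]
        exact hD _
      rw [Finset.sum_eq_zero, h2, add_zero]
      intro w _
      rw [if_neg]
      intro h
      obtain ⟨u, hu⟩ := w.2.exists_eq_append
      rw [hu, endsWith_append, Nat.testBit_zero] at h
      have := h.1
      simp at this
      omega

end Telescoping

/-! ### Logarithmic derivatives of power series -/

section LogDeriv

open PowerSeries

variable {K : Type*} [Field K]

/-- The logarithmic derivative of a power series. -/
noncomputable def ld (f : PowerSeries K) : PowerSeries K := derivative K f * f⁻¹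

theorem ld_mul_self {f : PowerSeries K} (hf : constantCoeff f ≠ 0) :
    ld f * f = derivative K f := by
  rw [ld, mul_assoc, PowerSeries.inv_mul_cancel _ hf, mul_one]

theorem ld_one : ld (1 : PowerSeries K) = 0 := by simp [ld]

theorem ld_mul {f g : PowerSeries K} (hf : constantCoeff f ≠ 0) (hg : constantCoeff g ≠ 0) :
    ld (f * g) = ld f + ld g := by
  have hfg : constantCoeff (f * g) ≠ 0 := by rw [map_mul]; exact mul_ne_zero hf hg
  have h0 : f * g ≠ 0 := fun h => hfg (by rw [h, map_zero])
  refine mul_right_cancel₀ h0 ?_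
  rw [ld_mul_self hfg, Derivation.leibniz, smul_eq_mul, smul_eq_mul, ← ld_mul_self hf,
    ← ld_mul_self hg]
  ring

theorem ld_pow {f : PowerSeries K} (hf : constantCoeff f ≠ 0) (n : ℕ) : ld (f ^ n) = n • ld f := by
  induction n with
  | zero => simp [ld_one]
  | succ n ih =>
    rw [pow_succ, ld_mul (by rw [map_pow]; exact pow_ne_zero _ hf) hf, ih, succ_nsmul]

theorem ld_prod {ι : Type*} (s : Finset ι) (f : ι → PowerSeries K)
    (hf : ∀ i ∈ s, constantCoeff (f i) ≠ 0) : ld (∏ i ∈ s, f i) = ∑ i ∈ s, ld (f i) := by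
  classical
  induction s using Finset.induction_on with
  | empty => simp [ld_one]
  | insert a s ha ih =>
    have h1 := fun i hi => hf i (Finset.mem_insert_of_mem hi)
    rw [Finset.prod_insert ha, Finset.sum_insert ha, ld_mul (hf a (Finset.mem_insert_self a s)),
      ih h1]
    rw [map_prod]
    exact Finset.prod_ne_zero_iff.2 h1

theorem map_ld {L : Type*} [Field L] (φ : K →+* L) {f : PowerSeries K}
    (hf : constantCoeff f ≠ 0) : PowerSeries.map φ (ld f) = ld (PowerSeries.map φ f) := by
  have h1 : constantCoeff (PowerSeries.map φ f) ≠ 0 := by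
    rw [← coeff_zero_eq_constantCoeff_apply, coeff_map, coeff_zero_eq_constantCoeff_apply]
    exact (map_ne_zero φ).2 hf
  have h0 : PowerSeries.map φ f ≠ 0 := fun h => h1 (by rw [h, map_zero])
  refine mul_right_cancel₀ h0 ?_
  rw [ld_mul_self h1, ← map_mul, ld_mul_self hf]
  ext n
  simp [coeff_derivative]

theorem coeff_ld_one_sub (a : K) (n : ℕ) : coeff n (ld (1 - C a * X)) = -a ^ (n + 1) := by
  have hc : constantCoeff (1 - C a * X : PowerSeries K) ≠ 0 := by simp
  have h0 : (1 - C a * X : PowerSeries K) ≠ 0 := fun h => hc (by rw [h, map_zero])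
  have h : ld (1 - C a * X) = PowerSeries.mk fun n => -a ^ (n + 1) := by
    refine mul_right_cancel₀ h0 ?_
    rw [ld_mul_self hc]
    ext n
    rw [mul_sub, mul_one, ← mul_assoc, mul_comm _ (C a), mul_assoc]
    rcases n with _ | n
    · simp
    · simp [coeff_succ_mul_X]
      ring
  rw [h, coeff_mk]

/-- Series that agree to high order have logarithmic derivatives that agree to high order. -/
theorem coeff_ld_sub {f g : PowerSeries K} (hf : constantCoeff f ≠ 0) (hg : constantCoeff g ≠ 0)
    {c : K} {k : ℕ} (h : f - g = C c * X ^ (k + 1)) {i : ℕ} (hi : i < k) :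
    coeff i (ld f - ld g) = 0 := by
  -- Multiplying by `f * g` gives `(f - g)' g - g' (f - g)`, where differentiation costs one power
  -- of `X`; `f * g` is a unit.
  have hd : X ^ k ∣ (ld f - ld g) * (f * g) := by
    have h1 : (ld f - ld g) * (f * g) = derivative K (f - g) * g - derivative K g * (f - g) := by
      rw [map_sub, ← ld_mul_self hf, ← ld_mul_self hg]; ring
    rw [h1, h, Derivation.leibniz, derivative_C, smul_zero, add_zero, derivative_pow]
    simp only [Nat.add_sub_cancel, smul_eq_mul]
    exact dvd_sub ⟨C c * (k + 1) * derivative K X * g, by push_cast; ring⟩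
      (((pow_dvd_pow X k.le_succ).mul_left _).mul_left _)
  have h2 : ld f - ld g = (ld f - ld g) * (f * g) * (f⁻¹ * g⁻¹) := by
    have e1 := PowerSeries.mul_inv_cancel f hf
    have e2 := PowerSeries.mul_inv_cancel g hg
    linear_combination (-(ld f - ld g) * g * g⁻¹) * e1 - (ld f - ld g) * e2
  rw [h2]
  exact X_pow_dvd_iff.1 (hd.mul_right _) i hi

end LogDeriv

/-! ### Logarithmic derivatives of the normalized row polynomials -/

section Poly

variable (K : Type*) [Field K]

/-- The `i`-th coefficient of the logarithmic derivative of the normalized row polynomial. -/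
noncomputable def ldCoeff (i n : ℕ) : K := PowerSeries.coeff i (ld (normT K n : PowerSeries K))

theorem ldCoeff_zero (i : ℕ) : ldCoeff K i 0 = 0 := by
  rw [ldCoeff, normT_zero, Polynomial.coe_one, ld_one, map_zero]

variable [CharZero K]

theorem ldCoeff_odd (i m : ℕ) : ldCoeff K i (2 * m + 1) = ldCoeff K i m := by
  rw [ldCoeff, normT_odd, ldCoeff]

/-- The coefficients of the logarithmic derivative of `r_w`. -/
theorem secondDiff_ldCoeff (i n : ℕ) : secondDiff (ldCoeff K i) n
    = PowerSeries.coeff i (ld ((normT K n * normT K (dropTop n / 2) : Polynomial K) : PowerSeries K)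
      - ld ((normT K (n / 2) * normT K (dropTop n) : Polynomial K) : PowerSeries K)) := by
  have h : ∀ n, PowerSeries.constantCoeff (normT K n : PowerSeries K) ≠ 0 := fun n => by
    simp [normT_coeff_zero]
  rw [Polynomial.coe_mul, Polynomial.coe_mul, ld_mul (h _) (h _), ld_mul (h _) (h _)]
  simp only [secondDiff, ldCoeff, map_sub, map_add]
  ring

theorem normT_det_wordValue (w : AdmissibleWord) : ∃ c : K, c ≠ 0 ∧
    normT K (wordValue w.1) * normT K (dropTop (wordValue w.1) / 2)
      - normT K (wordValue w.1 / 2) * normT K (dropTop (wordValue w.1))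
      = Polynomial.C c * Polynomial.X ^ (w.1.length - 1) := by
  obtain ⟨m, hm⟩ := w.2.two_dvd
  have hm0 : m ≠ 0 := by rintro rfl; have := w.2.wordValue_pos; omega
  have h1 : dropTop (2 * m) = 2 * dropTop m := dropTop_bit m 0 hm0 (by norm_num)
  have h2 : Nat.log 2 (2 * m) = Nat.log 2 m + 1 := log_two_bit m 0 hm0 (by norm_num)
  obtain ⟨c, hc, h⟩ := normT_det K m hm0
  refine ⟨c, hc, ?_⟩
  rw [w.2.length_eq, hm, h1, h2]
  simpa using h

/-- Numerator and denominator of `r_w` agree up to order `x^(μ-1)`, so `r_w'/r_w` has no terms below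
`x^(μ-2)`. This is why the cutoff is `i + 2`. -/
theorem secondDiff_ldCoeff_eq_zero (i : ℕ) (w : AdmissibleWord) (hw : w ∉ wordsUpTo (i + 2)) :
    secondDiff (ldCoeff K i) (wordValue w.1) = 0 := by
  rw [mem_wordsUpTo, not_le] at hw
  obtain ⟨c, _, h⟩ := normT_det_wordValue K w
  rw [secondDiff_ldCoeff]
  have h' := congrArg (fun p : Polynomial K => (p : PowerSeries K)) h
  simp only [Polynomial.coe_sub, Polynomial.coe_mul (Polynomial.C c), Polynomial.coe_C,
    Polynomial.coe_pow, Polynomial.coe_X] at h'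
  obtain ⟨k, hk⟩ : ∃ k, w.1.length - 1 = k + 1 := ⟨w.1.length - 2, by omega⟩
  rw [hk] at h'
  refine coeff_ld_sub ?_ ?_ h' (by omega) <;>
    simp [normT_coeff_zero]

end Poly

/-! ### The representing polynomials -/

/-- The linear form `∑_w [x^i](r_w'/r_w) X_w`. -/
noncomputable def linearForm (i : ℕ) : MvPolynomial AdmissibleWord ℚ :=
  ∑ w ∈ wordsUpTo (i + 2),
    MvPolynomial.C (secondDiff (ldCoeff ℚ i) (wordValue w.1)) * MvPolynomial.X w

/-- The polynomials `P_j`, by the recurrence for the coefficients of an exponential. -/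
noncomputable def quotientPoly : ℕ → MvPolynomial AdmissibleWord ℚ
  | 0 => 1
  | j + 1 => MvPolynomial.C ((j + 1 : ℚ)⁻¹) *
      ∑ i : Fin (j + 1), linearForm i * quotientPoly (j - i)
  decreasing_by omega

theorem eval_linearForm (i n : ℕ) :
    MvPolynomial.eval (fun w : AdmissibleWord => (factorCount n w.1 : ℚ)) (linearForm i)
      = ldCoeff ℚ i n := by
  have h := sum_factorCount (ldCoeff ℚ i) (ldCoeff_odd ℚ i) (wordsUpTo (i + 2))
    (secondDiff_ldCoeff_eq_zero ℚ i) n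
  rw [ldCoeff_zero, sub_zero] at h
  rw [linearForm, map_sum, ← h]
  refine Finset.sum_congr rfl fun w _ => ?_
  rw [map_mul, MvPolynomial.eval_C, MvPolynomial.eval_X, nsmul_eq_mul, mul_comm]

/-- The recursion is the coefficient form of `T̄' = (T̄'/T̄) · T̄`, with the linear forms evaluating
to the coefficients of `T̄'/T̄`. -/
theorem quotientPoly_represents (j : ℕ) : Represents j (quotientPoly j) := by
  intro n
  rw [← coeff_normT]
  induction j using Nat.strong_induction_on with
  | _ j ih =>
    rcases j with _ | j
    · simp [quotientPoly, normT_coeff_zero]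
    · rw [quotientPoly, map_mul, MvPolynomial.eval_C, map_sum]
      have h1 : ∀ i : Fin (j + 1),
          MvPolynomial.eval (fun w : AdmissibleWord => (factorCount n w.1 : ℚ))
            (linearForm i * quotientPoly (j - i))
          = ldCoeff ℚ i n * (normT ℚ n).coeff (j - i) := fun i => by
        rw [map_mul, eval_linearForm, ih (j - i) (by omega)]
      rw [Finset.sum_congr rfl fun i _ => h1 i]
      have h2 : PowerSeries.constantCoeff (normT ℚ n : PowerSeries ℚ) ≠ 0 := by
        simp [normT_coeff_zero]
      have h3 := congrArg (PowerSeries.coeff j) (ld_mul_self h2)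
      rw [PowerSeries.coeff_derivative, PowerSeries.coeff_mul,
        Finset.Nat.sum_antidiagonal_eq_sum_range_succ_mk, Finset.sum_range] at h3
      simp only [Polynomial.coeff_coe] at h3
      simp only [ldCoeff]
      rw [h3]
      field_simp

theorem coeff_linearForm_mul (i : ℕ) (w : AdmissibleWord) (Q : MvPolynomial AdmissibleWord ℚ) :
    MvPolynomial.coeff (Finsupp.single w 1) (linearForm i * Q)
      = secondDiff (ldCoeff ℚ i) (wordValue w.1) * MvPolynomial.coeff 0 Q := by
  classical
  have h1 : ∀ v ∈ wordsUpTo (i + 2), MvPolynomial.coeff (Finsupp.single w 1)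
      (MvPolynomial.C (secondDiff (ldCoeff ℚ i) (wordValue v.1)) * MvPolynomial.X v * Q)
      = if v = w then secondDiff (ldCoeff ℚ i) (wordValue w.1) * MvPolynomial.coeff 0 Q else 0 := by
    intro v _
    rw [mul_assoc, MvPolynomial.coeff_C_mul, MvPolynomial.coeff_X_mul']
    by_cases h : v = w
    · subst h; simp
    · simp [h]
  rw [linearForm, Finset.sum_mul, MvPolynomial.coeff_sum, Finset.sum_congr rfl h1,
    Finset.sum_ite_eq']
  split_ifs with h
  · rfl
  · rw [secondDiff_ldCoeff_eq_zero ℚ i w h, zero_mul]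

theorem coeff_zero_linearForm_mul (i : ℕ) (Q : MvPolynomial AdmissibleWord ℚ) :
    MvPolynomial.coeff 0 (linearForm i * Q) = 0 := by
  rw [← MvPolynomial.constantCoeff_eq, map_mul, linearForm, map_sum]
  simp

theorem coeff_zero_quotientPoly (j : ℕ) :
    MvPolynomial.coeff 0 (quotientPoly j) = if j = 0 then 1 else 0 := by
  rcases j with _ | j
  · simp [quotientPoly]
  · rw [quotientPoly, MvPolynomial.coeff_C_mul, MvPolynomial.coeff_sum]
    simp [coeff_zero_linearForm_mul]

theorem coeff_single_quotientPoly_zero (w : AdmissibleWord) :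
    MvPolynomial.coeff (Finsupp.single w 1) (quotientPoly 0) = 0 := by
  classical
  rw [quotientPoly, MvPolynomial.coeff_one, if_neg]
  exact (Finsupp.single_ne_zero.2 one_ne_zero).symm

/-- A linear form times `Q` sees only the constant term of `Q` in degree one, and `P_j` has zero
constant term for `j > 0`; only the summand with `P_0` remains. -/
theorem coeff_single_quotientPoly_succ (w : AdmissibleWord) (j : ℕ) :
    MvPolynomial.coeff (Finsupp.single w 1) (quotientPoly (j + 1))
      = secondDiff (ldCoeff ℚ j) (wordValue w.1) / (j + 1) := by
  rw [quotientPoly, MvPolynomial.coeff_C_mul, MvPolynomial.coeff_sum, Finset.sum_eq_single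
    (Fin.last j)]
  · rw [coeff_linearForm_mul, coeff_zero_quotientPoly]
    simp
    ring
  · intro i _ hi
    have : (i : ℕ) < j := Fin.val_lt_last hi
    rw [coeff_linearForm_mul, coeff_zero_quotientPoly, if_neg (by omega), mul_zero]
  · simp

/-! ### Algebraic independence of the factor counts -/

theorem wordValue_append' (u v : Word) :
    wordValue (u ++ v) = wordValue u * 2 ^ v.length + wordValue v := by
  induction v using List.reverseRecOn with
  | nil => simp [wordValue_nil]
  | append_singleton v b ih =>
    rw [← List.append_assoc, wordValue_append, ih, wordValue_append, List.length_append,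
      List.length_singleton, pow_succ]
    ring

theorem endsWith_append_left {u v w : Word} (h : w.length ≤ v.length) :
    EndsWith (wordValue (u ++ v)) w ↔ EndsWith (wordValue v) w := by
  obtain ⟨k, hk⟩ := Nat.exists_eq_add_of_le h
  unfold EndsWith
  rw [wordValue_append', hk, pow_add, mul_left_comm, Nat.mul_add_mod]

/-- The vector of factor counts of a word. -/
noncomputable def countVec (x : Word) (w : AdmissibleWord) : ℚ := factorCount (wordValue x) w.1

theorem countVec_append_singleton (x : Word) (b : Bool) (w : AdmissibleWord) :
    countVec (x ++ [b]) w
      = countVec x w + if EndsWith (wordValue (x ++ [b])) w.1 then 1 else 0 := by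
  have h : wordValue (x ++ [b]) / 2 = wordValue x := by
    rw [← wordValue_truncR, truncR, List.dropLast_concat]
  rw [countVec, factorCount_succ w.2, h, countVec]
  push_cast
  rfl

theorem not_endsWith_append_true (x : Word) (w : AdmissibleWord) :
    ¬ EndsWith (wordValue (x ++ [true])) w.1 := by
  obtain ⟨u, hu⟩ := w.2.exists_eq_append
  rw [hu, endsWith_append, wordValue_append]
  simp

theorem countVec_append_ones (x : Word) (k : ℕ) (w : AdmissibleWord) :
    countVec (x ++ List.replicate k true) w = countVec x w := by
  induction k with
  | zero => simp
  | succ k ih =>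
    rw [List.replicate_succ', ← List.append_assoc, countVec_append_singleton, ih,
      if_neg (not_endsWith_append_true _ w), add_zero]

theorem countVec_nil (w : AdmissibleWord) : countVec [] w = 0 := by
  rw [countVec, wordValue_nil, factorCount_zero w.2, Nat.cast_zero]

/-- The count vector of `v` preceded by a run of `k` ones. -/
noncomputable def blockVec (k : ℕ) (v : Word) : AdmissibleWord → ℚ :=
  countVec (List.replicate k true ++ v)

/-- The run of `k` ones shields `v` from `x`: a word of length at most `k` that ends inside `v` lies
within the block, and no admissible word ends on a 1. -/
theorem countVec_append_block {k : ℕ} (x v : Word) {w : AdmissibleWord} (hw : w.1.length ≤ k) :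
    countVec (x ++ (List.replicate k true ++ v)) w = countVec x w + blockVec k v w := by
  induction v using List.reverseRecOn with
  | nil =>
    have h := countVec_append_ones [] k w
    rw [List.nil_append, countVec_nil] at h
    rw [blockVec, List.append_nil, countVec_append_ones, h, add_zero]
  | append_singleton v b ih =>
    rw [blockVec, ← List.append_assoc _ v [b], ← List.append_assoc, countVec_append_singleton, ih,
      countVec_append_singleton, blockVec, ← add_assoc, List.append_assoc x,
      if_congr (endsWith_append_left (by simp; omega)) rfl rfl]

/-- Triangularity with respect to length: words shorter than `v` are killed, while longer words are
left uncontrolled. -/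
theorem exists_triangular (k : ℕ) (v : AdmissibleWord) (hv : v.1.length ≤ k) :
    ∃ g ∈ Submodule.span ℚ (Set.range (blockVec k)), ∀ w : AdmissibleWord,
      w.1.length ≤ v.1.length → g w = if w = v then 1 else 0 := by
  obtain ⟨t, ht⟩ := v.2.exists_eq_cons
  have hmem : ∀ x, blockVec k x ∈ Submodule.span ℚ (Set.range (blockVec k)) :=
    fun x => Submodule.subset_span ⟨x, rfl⟩
  have h2 := v.2.1
  rw [ht, List.length_cons] at h2
  obtain ⟨u, hu⟩ : ∃ u, t = u ++ [false] := by
    have h := v.2.2.2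
    induction t using List.reverseRecOn with
    | nil => simp at h2
    | append_singleton u b _ =>
      rw [ht, ← List.cons_append, List.getLast?_concat, Option.some_inj] at h
      exact ⟨u, by rw [h]⟩
  -- With `v = 1u0`, appending the final 0 adds the suffix indicator of `1u0` or of `0u0`. These
  -- agree on words shorter than `v`, and on words of equal length only `1u0` is admissible.
  refine ⟨blockVec k (true :: u ++ [false]) - blockVec k (true :: u)
    - (blockVec k (false :: u ++ [false]) - blockVec k (false :: u)),
    sub_mem (sub_mem (hmem _) (hmem _)) (sub_mem (hmem _) (hmem _)), fun w hw => ?_⟩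
  have hlen : v.1.length = u.length + 2 := by rw [ht, hu]; simp
  have key : ∀ b : Bool, blockVec k (b :: u ++ [false]) w - blockVec k (b :: u) w
      = if EndsWith (wordValue (b :: u ++ [false])) w.1 then 1 else 0 := fun b => by
    rw [blockVec, ← List.append_assoc, countVec_append_singleton, blockVec, add_sub_cancel_left,
      List.append_assoc, if_congr (endsWith_append_left (by simp; omega)) rfl rfl]
  simp only [Pi.sub_apply, key]
  rcases hw.lt_or_eq with h | h
  · have h3 : w ≠ v := by rintro rfl; exact lt_irrefl _ h
    have h4 : ∀ b : Bool, EndsWith (wordValue (b :: u ++ [false])) w.1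
        ↔ EndsWith (wordValue (u ++ [false])) w.1 := fun b => by
      rw [show b :: u ++ [false] = [b] ++ (u ++ [false]) by rfl]
      exact endsWith_append_left (by simp; omega)
    rw [if_neg h3, if_congr (h4 true) rfl rfl, if_congr (h4 false) rfl rfl, sub_self]
  · have h4 : ∀ b : Bool, EndsWith (wordValue (b :: u ++ [false])) w.1
        ↔ b :: u ++ [false] = w.1 := fun b => by
      have h5 : (b :: u ++ [false]).length = w.1.length := by simp; omega
      unfold EndsWith
      rw [← h5, Nat.mod_eq_of_lt (wordValue_lt _)]
      exact ⟨wordValue_injective_of_length h5, congrArg _⟩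
    have h6 : ¬ (false :: u ++ [false] = w.1) := fun h => by
      obtain ⟨s, hs⟩ := w.2.exists_eq_cons
      rw [hs] at h
      simp at h
    have h7 : true :: u ++ [false] = w.1 ↔ w = v := by
      rw [← Subtype.coe_inj, ht, hu, eq_comm]
      rfl
    rw [if_congr (h4 true) rfl rfl, if_congr (h4 false) rfl rfl, if_neg h6, sub_zero,
      if_congr h7 rfl rfl]

theorem exists_span_eq_on (k : ℕ) (f : AdmissibleWord → ℚ) :
    ∃ h ∈ Submodule.span ℚ (Set.range (blockVec k)), ∀ w : AdmissibleWord,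
      w.1.length ≤ k → h w = f w := by
  classical
  suffices H : ∀ d : ℕ, ∀ f : AdmissibleWord → ℚ,
      (∀ w : AdmissibleWord, w.1.length + d ≤ k → f w = 0) →
      ∃ h ∈ Submodule.span ℚ (Set.range (blockVec k)), ∀ w : AdmissibleWord,
        w.1.length ≤ k → h w = f w by
    -- The induction matches `f` from short words to long ones. Starting at `d = k` the vanishing
    -- hypothesis is vacuous, admissible words having length at least 2.
    refine H k f fun w hw => ?_
    have := w.2.1
    omega
  intro d
  induction d with
  | zero => exact fun f hf => ⟨0, zero_mem _, fun w hw => (hf w hw).symm⟩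
  | succ d ih =>
    intro f hf
    choose! g hg1 hg2 using exists_triangular k
    set S := (wordsUpTo (k - d)).filter (fun v => v.1.length + d = k) with hS
    have hmemS : ∀ v, v ∈ S ↔ v.1.length + d = k := fun v => by
      rw [hS, Finset.mem_filter, mem_wordsUpTo]; omega
    have hsum : ∀ w : AdmissibleWord, w.1.length + d ≤ k →
        (∑ v ∈ S, f v • g v) w = f w := fun w hw => by
      rw [Finset.sum_apply]
      have h1 : ∀ v ∈ S, (f v • g v) w = if w = v then f w else 0 := fun v hv => by
        rw [hmemS] at hv
        rw [Pi.smul_apply, hg2 v (by omega) w (by omega), smul_eq_mul]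
        split_ifs with h
        · rw [h, mul_one]
        · rw [mul_zero]
      rw [Finset.sum_congr rfl h1, Finset.sum_ite_eq]
      split_ifs with h
      · rfl
      · rw [hmemS] at h
        exact (hf w (by omega)).symm
    obtain ⟨h, h1, h2⟩ := ih (f - ∑ v ∈ S, f v • g v) fun w hw => by
      rw [Pi.sub_apply, hsum w hw, sub_self]
    refine ⟨h + ∑ v ∈ S, f v • g v, add_mem h1 (sum_mem fun v hv => Submodule.smul_mem _ _
      (hg1 v (by have := (hmemS v).1 hv; omega))), fun w hw => ?_⟩
    rw [Pi.add_apply, h2 w hw, Pi.sub_apply, sub_add_cancel]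

theorem eval_congr_of_vars {σ R : Type*} [CommRing R] {Q : MvPolynomial σ R} {x y : σ → R}
    (h : ∀ i ∈ Q.vars, x i = y i) : MvPolynomial.eval x Q = MvPolynomial.eval y Q :=
  MvPolynomial.eval₂Hom_congr' rfl (fun i hi _ => h i hi) rfl

/-- A polynomial that vanishes at natural points of a line vanishes on the whole line. -/
theorem eval_line_eq_zero {σ : Type*} (Q : MvPolynomial σ ℚ) (x y : σ → ℚ)
    (h : ∀ t : ℕ, MvPolynomial.eval (x + (t : ℚ) • y) Q = 0) (q : ℚ) :
    MvPolynomial.eval (x + q • y) Q = 0 := by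
  set p : Polynomial ℚ :=
    MvPolynomial.aeval (fun i => Polynomial.C (x i) + Polynomial.X * Polynomial.C (y i)) Q with hp
  have hev : ∀ t : ℚ, p.eval t = MvPolynomial.eval (x + t • y) Q := fun t => by
    rw [hp]
    clear h hp p
    induction Q using MvPolynomial.induction_on with
    | C a => simp
    | add p q h1 h2 => simp_all
    | mul_X p i h1 => 
      rw [map_mul, map_mul, Polynomial.eval_mul, h1]
      simp [mul_comm t]
  have h0 : p = 0 := by
    refine Polynomial.eq_zero_of_infinite_isRoot _
      (Set.infinite_of_injective_forall_mem (f := fun t : ℕ => (t : ℚ)) Nat.cast_injective fun t => ?_)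
    rw [Set.mem_ofPred_eq, Polynomial.IsRoot, hev, h]
  rw [← hev, h0, Polynomial.eval_zero]

/-- Repeating a block moves the count vector along an arithmetic progression, so `Q` vanishes on the
whole line. Iterating over blocks, `Q` vanishes on their span, which realizes all values of the
variables occurring in `Q`. -/
theorem eq_zero_of_eval_factorCount (Q : MvPolynomial AdmissibleWord ℚ)
    (hQ : ∀ n : ℕ, MvPolynomial.eval (fun w : AdmissibleWord => (factorCount n w.1 : ℚ)) Q = 0) :
    Q = 0 := by
  obtain ⟨k, hk⟩ : ∃ k, ∀ w ∈ Q.vars, w.1.length ≤ k :=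
    ⟨Q.vars.sup fun w => w.1.length, fun w hw => Finset.le_sup (f := fun w => w.1.length) hw⟩
  -- The statement is kept for all words `x` and a fixed shift `y`, so that directions can be added
  -- one at a time.
  have step : ∀ y : AdmissibleWord → ℚ,
      (∀ x : Word, MvPolynomial.eval (countVec x + y) Q = 0) →
      ∀ (v : Word) (q : ℚ) (x : Word), MvPolynomial.eval (countVec x + (y + q • blockVec k v)) Q = 0 := by
    intro y hy v q x
    rw [← add_assoc]
    refine eval_line_eq_zero Q _ _ (fun t => ?_) q
    induction t generalizing x with
    | zero => simpa using hy x
    | succ t ih =>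
      rw [← ih (x ++ (List.replicate k true ++ v))]
      refine eval_congr_of_vars fun w hw => ?_
      simp only [Pi.add_apply, Pi.smul_apply, smul_eq_mul, countVec_append_block x v (hk w hw)]
      push_cast
      ring
  have hspan : ∀ h ∈ Submodule.span ℚ (Set.range (blockVec k)), ∀ y : AdmissibleWord → ℚ,
      (∀ x : Word, MvPolynomial.eval (countVec x + y) Q = 0) →
      ∀ x : Word, MvPolynomial.eval (countVec x + (y + h)) Q = 0 := by
    intro h hh
    induction hh using Submodule.closure_induction with
    | zero => intro y hy; simpa using hy
    | add a b _ _ ha hb =>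
      intro y hy
      rw [← add_assoc]
      exact hb _ (ha y hy)
    | smul_mem q b hb =>
      obtain ⟨v, rfl⟩ := hb
      exact fun y hy => step y hy v q
  refine MvPolynomial.funext fun f => ?_
  obtain ⟨h, h1, h2⟩ := exists_span_eq_on k f
  have h3 := hspan h h1 0 (fun x => by rw [add_zero]; exact hQ _) []
  rw [zero_add] at h3
  rw [map_zero, ← h3]
  refine eval_congr_of_vars fun w hw => ?_
  rw [Pi.add_apply, countVec_nil, zero_add, h2 w (hk w hw)]

theorem Represents.unique {j : ℕ} {P Q : MvPolynomial AdmissibleWord ℚ} (hP : Represents j P)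
    (hQ : Represents j Q) : P = Q :=
  sub_eq_zero.1 (eq_zero_of_eval_factorCount _ fun n => by rw [map_sub, hP n, hQ n, sub_self])

/-! ### The rational functions `r_w` and their factorizations -/

section Quotient

variable (K : Type*) [Field K]

/-- The numerator of `r_w`. -/
noncomputable def numP (w : AdmissibleWord) : Polynomial K :=
  normT K (wordValue w.1) * normT K (dropTop (wordValue w.1) / 2)

/-- The denominator of `r_w`. -/
noncomputable def denP (w : AdmissibleWord) : Polynomial K :=
  normT K (wordValue w.1 / 2) * normT K (dropTop (wordValue w.1))

theorem r_eq (w : AdmissibleWord) : r K w.1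
    = algebraMap (Polynomial K) (RatFunc K) (numP K w)
      / algebraMap (Polynomial K) (RatFunc K) (denP K w) := by
  rw [r, Tbar_eq, Tbar_eq, Tbar_eq, Tbar_eq, wordValue_truncR, wordValue_truncR,
    wordValue_truncL _ w.2.2.1, numP, denP]

variable [CharZero K]

theorem numP_coeff_zero (w : AdmissibleWord) : (numP K w).coeff 0 = 1 := by
  simp [numP, Polynomial.mul_coeff_zero, normT_coeff_zero]

theorem denP_coeff_zero (w : AdmissibleWord) : (denP K w).coeff 0 = 1 := by
  simp [denP, Polynomial.mul_coeff_zero, normT_coeff_zero]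

theorem denP_ne_zero (w : AdmissibleWord) : denP K w ≠ 0 := fun h => by
  have := denP_coeff_zero K w
  rw [h] at this
  simp at this

theorem numP_ne_denP (w : AdmissibleWord) : numP K w ≠ denP K w := fun h => by
  obtain ⟨c, hc, h1⟩ := normT_det_wordValue K w
  rw [← numP, ← denP, h, sub_self, eq_comm] at h1
  exact mul_ne_zero (Polynomial.C_ne_zero.2 hc) (pow_ne_zero _ Polynomial.X_ne_zero) h1

end Quotient

theorem eval_normT_pos {t : ℝ} (ht : 0 < t) (n : ℕ) : 0 < (normT ℝ n).eval t := by
  have h : (0 : ℝ) < theta 0 n := by exact_mod_cast theta_zero_pos n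
  rw [normT, Polynomial.eval_mul, Polynomial.eval_C, T, Polynomial.eval_finsetSum]
  simp only [Polynomial.eval_pow, Polynomial.eval_X]
  have : 0 < ∑ t_1 ∈ Finset.range (n + 1), t ^ padicValNat 2 (n.choose t_1) :=
    Finset.sum_pos (fun i _ => by positivity) ⟨0, by simp⟩
  positivity

theorem eval_numP_pos {t : ℝ} (ht : 0 < t) (w : AdmissibleWord) : 0 < (numP ℝ w).eval t := by
  rw [numP, Polynomial.eval_mul]
  exact mul_pos (eval_normT_pos ht _) (eval_normT_pos ht _)

theorem eval_denP_pos {t : ℝ} (ht : 0 < t) (w : AdmissibleWord) : 0 < (denP ℝ w).eval t := by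
  rw [denP, Polynomial.eval_mul]
  exact mul_pos (eval_normT_pos ht _) (eval_normT_pos ht _)

theorem map_normT {K L : Type*} [Field K] [Field L] (φ : K →+* L) (n : ℕ) :
    (normT K n).map φ = normT L n := by
  ext j
  rw [Polynomial.coeff_map, coeff_normT, coeff_normT, map_div₀, map_natCast, map_natCast]

theorem eval_numP_ofReal (t : ℝ) (w : AdmissibleWord) :
    (numP ℂ w).eval (t : ℂ) = (((numP ℝ w).eval t : ℝ) : ℂ) := by
  rw [numP, ← map_normT Complex.ofRealHom, ← map_normT Complex.ofRealHom, ← Polynomial.map_mul,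
    ← numP]
  exact Polynomial.eval_map_apply (f := Complex.ofRealHom) t

theorem eval_denP_ofReal (t : ℝ) (w : AdmissibleWord) :
    (denP ℂ w).eval (t : ℂ) = (((denP ℝ w).eval t : ℝ) : ℂ) := by
  rw [denP, ← map_normT Complex.ofRealHom, ← map_normT Complex.ofRealHom, ← Polynomial.map_mul,
    ← denP]
  exact Polynomial.eval_map_apply (f := Complex.ofRealHom) t

/-- `RatFunc.eval` uses the reduced fraction; its denominator divides `denP`, which is positive at
1. -/
theorem eval_r_one (w : AdmissibleWord) : (r ℝ w.1).eval (RingHom.id ℝ) 1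
    = (numP ℝ w).eval 1 / (denP ℝ w).eval 1 := by
  have h := (eval_denP_pos one_pos w).ne'
  have h1 := (RatFunc.num_mul_eq_mul_denom_iff (denP_ne_zero ℝ w)).2 (r_eq ℝ w)
  have h2 := RatFunc.denom_div_dvd (numP ℝ w) (denP ℝ w)
  rw [← r_eq] at h2
  have h3 : (r ℝ w.1).denom.eval 1 ≠ 0 := fun h3 =>
    h (by simpa [h3] using Polynomial.eval_dvd (x := (1 : ℝ)) h2)
  have h4 := congrArg (Polynomial.eval 1) h1
  rw [Polynomial.eval_mul, Polynomial.eval_mul] at h4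
  rw [RatFunc.eval, Polynomial.eval₂_id, Polynomial.eval₂_id, div_eq_div_iff h3 h, h4]

theorem exists_prod_one_sub (p : Polynomial ℂ) (h : p.coeff 0 = 1) :
    ∃ s : Multiset ℂ, (0 ∉ s) ∧
      p = (s.map fun a => 1 - Polynomial.C a * Polynomial.X).prod := by
  have h0 : p ≠ 0 := by rintro rfl; simp at h
  have hr : ∀ a ∈ p.roots, a ≠ 0 := by
    rintro a ha rfl
    rw [Polynomial.mem_roots h0, Polynomial.IsRoot, ← Polynomial.coeff_zero_eq_eval_zero, h] at ha
    exact one_ne_zero ha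
  have h1 := (IsAlgClosed.splits p).eq_prod_roots
  have h2 : (p.roots.map fun a => Polynomial.X - Polynomial.C a)
      = p.roots.map fun a => Polynomial.C (-a) * (1 - Polynomial.C a⁻¹ * Polynomial.X) := by
    refine Multiset.map_congr rfl fun a ha => ?_
    have : Polynomial.C a * Polynomial.C a⁻¹ = 1 := by
      rw [← Polynomial.C_mul, mul_inv_cancel₀ (hr a ha), Polynomial.C_1]
    rw [Polynomial.C_neg]
    linear_combination (-Polynomial.X) * this
  rw [h2, Multiset.prod_map_mul, ← mul_assoc] at h1
  obtain ⟨c, hc⟩ : ∃ c : ℂ, Polynomial.C p.leadingCoeff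
      * (p.roots.map fun a => Polynomial.C (-a)).prod = Polynomial.C c :=
    ⟨p.leadingCoeff * (p.roots.map fun a => -a).prod, by
      rw [Polynomial.C_mul, map_multiset_prod, Multiset.map_map]; rfl⟩
  rw [hc] at h1
  refine ⟨p.roots.map fun a => a⁻¹, ?_, ?_⟩
  · rw [Multiset.mem_map]
    rintro ⟨a, ha, h3⟩
    exact hr a ha (inv_eq_zero.1 h3)
  · rw [Multiset.map_map]
    have h4 : c = 1 := by
      rw [h1, Polynomial.coeff_zero_eq_eval_zero, Polynomial.eval_mul, Polynomial.eval_C,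
        Polynomial.eval_multiset_prod, Multiset.map_map] at h
      simpa using h
    rw [h4, Polynomial.C_1, one_mul] at h1
    exact h1

/-- The factor `1 - a X` as a rational function. -/
noncomputable def linFactor (a : ℂ) : RatFunc ℂ := 1 - RatFunc.C a * RatFunc.X

theorem algebraMap_linFactor (a : ℂ) :
    algebraMap (Polynomial ℂ) (RatFunc ℂ) (1 - Polynomial.C a * Polynomial.X) = linFactor a := by
  simp [linFactor]

theorem linFactor_ne_zero (a : ℂ) : linFactor a ≠ 0 := by
  rw [← algebraMap_linFactor, Ne, FaithfulSMul.algebraMap_eq_zero_iff]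
  intro h
  have := congrArg (Polynomial.coeff · 0) h
  simp at this

theorem algebraMap_multiset_prod (s : Multiset ℂ) (S : Finset ℂ) (h : s.toFinset ⊆ S) :
    algebraMap (Polynomial ℂ) (RatFunc ℂ)
      (s.map fun a => 1 - Polynomial.C a * Polynomial.X).prod
      = ∏ a ∈ S, linFactor a ^ s.count a := by
  rw [map_multiset_prod, Multiset.map_map, Finset.prod_multiset_map_count,
    ← Finset.prod_subset h]
  · simp only [Function.comp_apply, algebraMap_linFactor]
  · intro a _ ha
    rw [Multiset.mem_toFinset] at ha
    rw [Multiset.count_eq_zero_of_notMem ha, pow_zero]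

theorem exists_isFactorization (w : AdmissibleWord) :
    ∃ (L : ℕ) (ξ : Fin (L + 1) → ℂ) (ε : Fin (L + 1) → ℤ), IsFactorization w.1 ξ ε := by
  classical
  obtain ⟨s, hs0, hs⟩ := exists_prod_one_sub _ (numP_coeff_zero ℂ w)
  obtain ⟨t, ht0, ht⟩ := exists_prod_one_sub _ (denP_coeff_zero ℂ w)
  set S : Finset ℂ := s.toFinset ∪ t.toFinset with hS
  set e : ℂ → ℤ := fun a => s.count a - t.count a with he
  have h1 : r ℂ w.1 = ∏ a ∈ S with e a ≠ 0, linFactor a ^ e a := by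
    rw [Finset.prod_filter_of_ne (p := fun a => e a ≠ 0)
      (fun a _ h h2 => h (by rw [h2, zpow_zero])), r_eq, hs, ht,
      algebraMap_multiset_prod s S Finset.subset_union_left,
      algebraMap_multiset_prod t S Finset.subset_union_right, ← Finset.prod_div_distrib]
    exact Finset.prod_congr rfl fun a _ => by
      rw [he, zpow_sub₀ (linFactor_ne_zero a), zpow_natCast, zpow_natCast]
  -- At least one factor survives cancellation because numerator and denominator differ.
  have h2 : (S.filter fun a => e a ≠ 0).Nonempty := by
    rw [Finset.nonempty_iff_ne_empty]
    intro h
    rw [h, Finset.prod_empty, r_eq, div_eq_one_iff_eq (by simpa using denP_ne_zero ℂ w)] at h1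
    exact numP_ne_denP ℂ w (RatFunc.algebraMap_injective ℂ h1)
  obtain ⟨L, hL⟩ := Nat.exists_eq_add_one.2 h2.card_pos
  set f := (S.filter fun a => e a ≠ 0).equivFinOfCardEq hL with hf
  set σ := Tuple.sort (fun i => -‖((f.symm i : _) : ℂ)‖) with hσ
  have hmono := Tuple.monotone_sort (fun i => -‖((f.symm i : _) : ℂ)‖)
  have hmem : ∀ i, e (f.symm i) ≠ 0 := fun i => (Finset.mem_filter.1 (f.symm i).2).2
  refine ⟨L, fun i => f.symm (σ i), fun i => e (f.symm (σ i)), ⟨?_, ?_, ?_, ?_, ?_⟩⟩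
  · exact Subtype.val_injective.comp (f.symm.injective.comp σ.injective)
  · intro i h
    have := (Finset.mem_filter.1 (f.symm (σ i)).2).1
    rw [h, Finset.mem_union, Multiset.mem_toFinset, Multiset.mem_toFinset] at this
    exact this.elim hs0 ht0
  · exact fun i => hmem _
  · exact fun i j hij => neg_le_neg_iff.1 (hmono hij)
  · rw [h1, ← Finset.prod_coe_sort, ← f.symm.prod_comp]
    exact (Equiv.prod_comp σ fun i => linFactor (f.symm i) ^ e (f.symm i)).symm

/-! ### Consequences of a factorization of `r_w` -/

section Factorization

variable {w : AdmissibleWord} {L : ℕ} {ξ : Fin L → ℂ} {ε : Fin L → ℤ}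

theorem IsFactorization.polynomial_eq (h : IsFactorization w.1 ξ ε) :
    numP ℂ w * ∏ i, (1 - Polynomial.C (ξ i) * Polynomial.X) ^ (-ε i).toNat
      = denP ℂ w * ∏ i, (1 - Polynomial.C (ξ i) * Polynomial.X) ^ (ε i).toNat := by
  refine RatFunc.algebraMap_injective ℂ ?_
  have h1 := h.eq_prod
  have h2 : ∀ i, (1 - RatFunc.C (ξ i) * RatFunc.X) ^ (ε i)
      = linFactor (ξ i) ^ (ε i).toNat / linFactor (ξ i) ^ (-ε i).toNat := fun i => by
    rw [← zpow_natCast, ← zpow_natCast, ← zpow_sub₀ (linFactor_ne_zero _),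
      Int.toNat_sub_toNat_neg, linFactor]
  rw [Finset.prod_congr rfl fun i _ => h2 i, r_eq, Finset.prod_div_distrib, div_eq_div_iff
    (by simpa using denP_ne_zero ℂ w)
    (Finset.prod_ne_zero_iff.2 fun i _ => pow_ne_zero _ (linFactor_ne_zero _))] at h1
  simp only [map_mul, map_prod, map_pow, algebraMap_linFactor]
  rw [h1, mul_comm]

/-- The `ξ_i` are the reciprocals of zeros and poles of `r_w`. -/
theorem IsFactorization.mul_ne_one (h : IsFactorization w.1 ξ ε) {t : ℝ} (ht : 0 < t)
    (i : Fin L) : ξ i * t ≠ 1 := by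
  intro h1
  have h2 := congrArg (Polynomial.eval (t : ℂ)) h.polynomial_eq
  simp only [Polynomial.eval_mul, Polynomial.eval_prod, Polynomial.eval_pow, Polynomial.eval_sub,
    Polynomial.eval_one, Polynomial.eval_C, Polynomial.eval_X] at h2
  have hA : (numP ℂ w).eval (t : ℂ) ≠ 0 := by
    rw [eval_numP_ofReal]; exact_mod_cast (eval_numP_pos ht w).ne'
  have hB : (denP ℂ w).eval (t : ℂ) ≠ 0 := by
    rw [eval_denP_ofReal]; exact_mod_cast (eval_denP_pos ht w).ne'
  have h3 : ∀ e : Fin L → ℕ, ∏ j, (1 - ξ j * (t : ℂ)) ^ e j = 0 ↔ e i ≠ 0 := fun e => by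
    rw [Finset.prod_eq_zero_iff]
    constructor
    · rintro ⟨j, _, hj⟩
      rw [pow_eq_zero_iff', sub_eq_zero, ← h1] at hj
      have htc : (t : ℂ) ≠ 0 := by exact_mod_cast ht.ne'
      rw [h.injective (mul_right_cancel₀ htc hj.1)]
      exact hj.2
    · exact fun hi => ⟨i, Finset.mem_univ i, by rw [h1, sub_self, zero_pow hi]⟩
  have h4 := h.exponent_ne_zero i
  -- At `t = 1/ξ_i` numerator and denominator of `r_w` are nonzero, so both products would vanish or
  -- neither; but `ξ_i` enters exactly one of them, according to the sign of `ε_i`.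
  have h5 : (∏ j, (1 - ξ j * (t : ℂ)) ^ (-ε j).toNat = 0)
      ↔ (∏ j, (1 - ξ j * (t : ℂ)) ^ (ε j).toNat = 0) := by
    constructor
    · intro h6
      rw [h6, mul_zero, eq_comm, mul_eq_zero] at h2
      exact h2.resolve_left hB
    · intro h6
      rw [h6, mul_zero, mul_eq_zero] at h2
      exact h2.resolve_left hA
  rw [h3, h3] at h5
  omega

theorem IsFactorization.eval_one (h : IsFactorization w.1 ξ ε) :
    (((numP ℝ w).eval 1 / (denP ℝ w).eval 1 : ℝ) : ℂ) = ∏ i, (1 - ξ i) ^ ε i := by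
  have h2 := congrArg (Polynomial.eval ((1 : ℝ) : ℂ)) h.polynomial_eq
  have h0 : ∀ i, 1 - ξ i ≠ 0 := fun i => by
    have := h.mul_ne_one one_pos i
    rw [Complex.ofReal_one, mul_one] at this
    exact sub_ne_zero.2 this.symm
  rw [Polynomial.eval_mul, Polynomial.eval_mul, eval_numP_ofReal, eval_denP_ofReal] at h2
  simp only [Polynomial.eval_prod, Polynomial.eval_pow, Polynomial.eval_sub,
    Polynomial.eval_one, Polynomial.eval_mul, Polynomial.eval_C, Polynomial.eval_X,
    Complex.ofReal_one, mul_one] at h2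
  have hB : (((denP ℝ w).eval 1 : ℝ) : ℂ) ≠ 0 := by exact_mod_cast (eval_denP_pos one_pos w).ne'
  have h3 : ∀ i, (1 - ξ i) ^ ε i = (1 - ξ i) ^ (ε i).toNat / (1 - ξ i) ^ (-ε i).toNat := fun i => by
    rw [← zpow_natCast, ← zpow_natCast, ← zpow_sub₀ (h0 i), Int.toNat_sub_toNat_neg]
  rw [Finset.prod_congr rfl fun i _ => h3 i, Finset.prod_div_distrib, Complex.ofReal_div,
    div_eq_div_iff hB (Finset.prod_ne_zero_iff.2 fun i _ => pow_ne_zero _ (h0 i)), h2, mul_comm]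

theorem IsFactorization.secondDiff_eq (h : IsFactorization w.1 ξ ε) (j : ℕ) :
    secondDiff (ldCoeff ℂ j) (wordValue w.1) = -∑ i, (ε i : ℂ) * ξ i ^ (j + 1) := by
  have h1 : ld ((_ : Polynomial ℂ) : PowerSeries ℂ) = ld ((_ : Polynomial ℂ) : PowerSeries ℂ) :=
    congrArg (fun p : Polynomial ℂ => ld (p : PowerSeries ℂ)) h.polynomial_eq
  have hf : ∀ i, PowerSeries.constantCoeff (1 - PowerSeries.C (ξ i) * PowerSeries.X) ≠ 0 :=
    fun i => by simp
  have hp : ∀ e : Fin L → ℕ, PowerSeries.constantCoeff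
      (∏ i, (1 - PowerSeries.C (ξ i) * PowerSeries.X) ^ e i) ≠ 0 := fun e => by
    rw [map_prod]
    exact Finset.prod_ne_zero_iff.2 fun i _ => by rw [map_pow]; exact pow_ne_zero _ (hf i)
  have hcoe : ∀ e : Fin L → ℕ,
      ((∏ i, (1 - Polynomial.C (ξ i) * Polynomial.X) ^ e i : Polynomial ℂ) : PowerSeries ℂ)
        = ∏ i, (1 - PowerSeries.C (ξ i) * PowerSeries.X) ^ e i := fun e => by
    rw [← Polynomial.coeToPowerSeries.ringHom_apply, map_prod]
    simp
  have hld : ∀ e : Fin L → ℕ, PowerSeries.coeff j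
      (ld (∏ i, (1 - PowerSeries.C (ξ i) * PowerSeries.X) ^ e i))
        = -∑ i, (e i : ℂ) * ξ i ^ (j + 1) := fun e => by
    rw [ld_prod _ _ fun i _ => by rw [map_pow]; exact pow_ne_zero _ (hf i), map_sum,
      ← Finset.sum_neg_distrib]
    refine Finset.sum_congr rfl fun i _ => ?_
    rw [ld_pow (hf i), map_nsmul, coeff_ld_one_sub, nsmul_eq_mul, mul_neg]
  rw [Polynomial.coe_mul, Polynomial.coe_mul (denP ℂ w), hcoe, hcoe,
    ld_mul (by simp [numP_coeff_zero]) (hp _), ld_mul (by simp [denP_coeff_zero]) (hp _)] at h1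
  have h2 := congrArg (PowerSeries.coeff j) h1
  rw [map_add, map_add, hld, hld] at h2
  rw [secondDiff_ldCoeff, ← numP, ← denP, map_sub]
  have h3 : ∑ i, (ε i : ℂ) * ξ i ^ (j + 1) = ∑ i, ((ε i).toNat : ℂ) * ξ i ^ (j + 1)
      - ∑ i, ((-ε i).toNat : ℂ) * ξ i ^ (j + 1) := by
    rw [← Finset.sum_sub_distrib]
    refine Finset.sum_congr rfl fun i _ => ?_
    rw [← sub_mul]
    congr 1
    exact_mod_cast (Int.toNat_sub_toNat_neg (ε i)).symm
  rw [h3]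
  linear_combination h2

theorem ldCoeff_ratCast (i n : ℕ) : ((ldCoeff ℚ i n : ℚ) : ℂ) = ldCoeff ℂ i n := by
  have h : PowerSeries.constantCoeff (normT ℚ n : PowerSeries ℚ) ≠ 0 := by
    simp [normT_coeff_zero]
  have h1 := congrArg (PowerSeries.coeff i) (map_ld (algebraMap ℚ ℂ) h)
  rw [PowerSeries.coeff_map, ← Polynomial.polynomial_map_coe, map_normT] at h1
  simpa [ldCoeff] using h1

theorem IsFactorization.coeffX_eq (h : IsFactorization w.1 ξ ε)
    {P : ℕ → MvPolynomial AdmissibleWord ℚ} (hP : ∀ j, Represents j (P j)) (j : ℕ) :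
    (coeffX w (P j) : ℂ) = -(∑ i, (ε i : ℂ) * ξ i ^ j) / j := by
  rw [(hP j).unique (quotientPoly_represents j), coeffX]
  rcases j with _ | j
  -- For `j = 0` both sides are 0, the right one by the convention `x / 0 = 0`.
  · simp [coeff_single_quotientPoly_zero]
  · rw [coeff_single_quotientPoly_succ, ← h.secondDiff_eq]
    simp only [secondDiff, ← ldCoeff_ratCast]
    push_cast
    rfl

end Factorization

/-! ### Asymptotics of power sums -/

/-- The logarithm series converges on the closed unit disc away from `1`. -/
theorem tendsto_sum_pow_div {z : ℂ} (hz : ‖z‖ ≤ 1) (h1 : z ≠ 1) :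
    Tendsto (fun N : ℕ => ∑ j ∈ Finset.range N, z ^ j / j) atTop (𝓝 (-Complex.log (1 - z))) := by
  have hanti : Antitone fun n : ℕ => 1 / ((n : ℝ) + 1) := fun m n h =>
    one_div_le_one_div_of_le (by positivity) (by exact_mod_cast Nat.succ_le_succ h)
  have hb : ∀ n : ℕ, ‖∑ i ∈ Finset.range n, z ^ (i + 1)‖ ≤ 2 / ‖z - 1‖ := fun n => by
    have h2 : ∑ i ∈ Finset.range n, z ^ (i + 1) = z * ((z ^ n - 1) / (z - 1)) := by
      rw [← geom_sum_eq h1, Finset.mul_sum]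
      exact Finset.sum_congr rfl fun i _ => pow_succ' z i
    rw [h2, norm_mul, norm_div]
    have h3 : ‖z ^ n - 1‖ ≤ 2 := by
      refine (norm_sub_le _ _).trans ?_
      rw [norm_pow, norm_one]
      linarith [pow_le_one₀ (n := n) (norm_nonneg z) hz]
    calc ‖z‖ * (‖z ^ n - 1‖ / ‖z - 1‖) ≤ 1 * (2 / ‖z - 1‖) := by gcongr
      _ = 2 / ‖z - 1‖ := one_mul _
  -- Dirichlet's test: the partial sums of the geometric series are bounded since `z ≠ 1`.
  obtain ⟨l, hl⟩ := cauchySeq_tendsto_of_complete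
    (hanti.cauchySeq_series_mul_of_tendsto_zero_of_bounded
      tendsto_one_div_add_atTop_nhds_zero_nat hb)
  have hl' : Tendsto (fun N : ℕ => ∑ j ∈ Finset.range N, z ^ j / j) atTop (𝓝 l) := by
    rw [← tendsto_add_atTop_iff_nat 1]
    refine hl.congr fun n => ?_
    rw [Finset.sum_range_succ']
    simp only [Nat.cast_zero, div_zero, add_zero, Complex.real_smul]
    refine Finset.sum_congr rfl fun i _ => ?_
    push_cast
    ring
  have hslit : 1 - z ∈ Complex.slitPlane := by
    left
    rw [Complex.sub_re, Complex.one_re, sub_pos]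
    refine lt_of_le_of_ne ((Complex.re_le_norm z).trans hz) fun h => h1 ?_
    have h2 : z.re ^ 2 + z.im ^ 2 ≤ 1 := by
      have h3 := Complex.normSq_eq_norm_sq z
      rw [Complex.normSq_apply] at h3
      nlinarith [norm_nonneg z]
    have h4 : z.im = 0 := by
      rw [h] at h2
      nlinarith [sq_nonneg z.im]
    exact Complex.ext h h4
  -- Abel's limit theorem identifies `l` with the radial limit of `-log (1 - z x)`, which is
  -- continuous at `x = 1` because `1 - z` has positive real part.
  have habel := Complex.tendsto_tsum_powerSeries_nhdsWithin_lt hl'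
  rw [tendsto_map'_iff] at habel
  have hlog : Tendsto (fun x : ℝ => -Complex.log (1 - z * x)) (𝓝[<] 1)
      (𝓝 (-Complex.log (1 - z))) := by
    have hc : ContinuousAt (fun x : ℝ => -Complex.log (1 - z * x)) 1 := by
      refine (ContinuousAt.clog (by fun_prop) ?_).neg
      simpa using hslit
    have := hc.tendsto.mono_left (nhdsWithin_le_nhds (s := Set.Iio 1))
    simpa using this
  have heq : ((fun y : ℂ => ∑' n : ℕ, z ^ n / n * y ^ n) ∘ Complex.ofReal)
      =ᶠ[𝓝[<] (1 : ℝ)] fun x : ℝ => -Complex.log (1 - z * x) := by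
    filter_upwards [Ioo_mem_nhdsLT (zero_lt_one (α := ℝ))] with x hx
    have hlt : ‖z * x‖ < 1 := by
      rw [norm_mul, Complex.norm_real, Real.norm_of_nonneg hx.1.le]
      nlinarith [hx.1, hx.2]
    rw [← (Complex.hasSum_taylorSeries_neg_log hlt).tsum_eq]
    refine tsum_congr fun n => ?_
    rw [mul_pow]
    ring
  rwa [tendsto_nhds_unique (habel.congr' heq) hlog] at hl'

/-! ### Power sums with distinct bases -/

section PowerSum

variable {L : ℕ} {z : Fin L → ℂ} {e : Fin L → ℂ}

/-- A power sum with distinct bases, one of which is `1`, does not tend to zero. -/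
theorem not_tendsto_powerSum (hz : Function.Injective z) {k : Fin L} (hk : z k = 1)
    (he : e k ≠ 0) : ¬ Tendsto (fun j : ℕ => ∑ i, e i * z i ^ j) atTop (𝓝 0) := by
  intro h
  -- Applying `p` of the shift operator annihilates every term except the `k`-th, leaving the
  -- nonzero constant `e k * p.eval (z k)`. No bound on the other bases is needed.
  set p : Polynomial ℂ := ∏ i ∈ Finset.univ.erase k, (Polynomial.X - Polynomial.C (z i)) with hp
  have hpz : ∀ i, i ≠ k → p.eval (z i) = 0 := fun i hi => by
    rw [hp, Polynomial.eval_prod]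
    exact Finset.prod_eq_zero (Finset.mem_erase.2 ⟨hi, Finset.mem_univ i⟩) (by simp)
  have hpk : p.eval (z k) ≠ 0 := by
    rw [hp, Polynomial.eval_prod]
    refine Finset.prod_ne_zero_iff.2 fun i hi => ?_
    rw [Polynomial.eval_sub, Polynomial.eval_X, Polynomial.eval_C]
    exact sub_ne_zero.2 fun h => (Finset.mem_erase.1 hi).1 (hz h).symm
  have h1 : ∀ j : ℕ, ∑ m ∈ Finset.range (p.natDegree + 1),
      p.coeff m * ∑ i, e i * z i ^ (j + m) = e k * p.eval (z k) := fun j => by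
    simp only [Finset.mul_sum]
    rw [Finset.sum_comm, Finset.sum_eq_single k]
    · rw [Polynomial.eval_eq_sum_range, Finset.mul_sum]
      refine Finset.sum_congr rfl fun m _ => ?_
      rw [hk]; simp only [one_pow]; ring
    · intro i _ hi
      have h2 := hpz i hi
      rw [Polynomial.eval_eq_sum_range] at h2
      calc ∑ m ∈ Finset.range (p.natDegree + 1), p.coeff m * (e i * z i ^ (j + m))
          = e i * z i ^ j * ∑ m ∈ Finset.range (p.natDegree + 1), p.coeff m * z i ^ m := by
            rw [Finset.mul_sum]
            exact Finset.sum_congr rfl fun m _ => by ring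
        _ = 0 := by rw [h2, mul_zero]
    · simp
  have h3 : Tendsto (fun j : ℕ => ∑ m ∈ Finset.range (p.natDegree + 1),
      p.coeff m * ∑ i, e i * z i ^ (j + m)) atTop
      (𝓝 (∑ m ∈ Finset.range (p.natDegree + 1), p.coeff m * 0)) :=
    tendsto_finsetSum _ fun m _ => ((tendsto_add_atTop_iff_nat m).2 h).const_mul _
  simp only [h1, mul_zero, Finset.sum_const_zero] at h3
  exact mul_ne_zero he hpk (tendsto_nhds_unique tendsto_const_nhds h3)

theorem tendsto_powerSum {k : Fin L} (hk : z k = 1) (hz : ∀ i, i ≠ k → ‖z i‖ < 1) :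
    Tendsto (fun j : ℕ => ∑ i, e i * z i ^ j) atTop (𝓝 (e k)) := by
  have h : ∀ i, Tendsto (fun j : ℕ => e i * z i ^ j) atTop (𝓝 (if i = k then e i else 0)) :=
    fun i => by
      split_ifs with hi
      · subst hi
        simp [hk]
      · simpa using (tendsto_pow_atTop_nhds_zero_of_norm_lt_one (hz i hi)).const_mul (e i)
  have h1 := tendsto_finsetSum Finset.univ fun i _ => h i
  simpa using h1

end PowerSum

theorem eq_one_of_tendsto_pow {z : ℂ} (h : Tendsto (fun j : ℕ => z ^ j) atTop (𝓝 1)) : z = 1 := by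
  have h1 := (tendsto_add_atTop_iff_nat 1).2 h
  have h2 := h.mul_const z
  simp only [← pow_succ, one_mul] at h2
  exact tendsto_nhds_unique h2 h1

/-! ### Limits and asymptotics of the coefficients -/

section Coefficients

variable {c : ℕ → ℝ} {L : ℕ} {ξ : Fin (L + 1) → ℂ} {ε : Fin (L + 1) → ℤ}

theorem mul_div_pow_eq (hc : ∀ j : ℕ, (c j : ℂ) = -(∑ i, (ε i : ℂ) * ξ i ^ j) / j) {j : ℕ}
    (hj : j ≠ 0) : (c j : ℂ) * (j / ξ 0 ^ j) = ∑ i, (-(ε i : ℂ)) * (ξ i / ξ 0) ^ j := by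
  have hj' : (j : ℂ) ≠ 0 := by exact_mod_cast hj
  rw [hc]
  simp only [neg_mul, Finset.sum_neg_distrib, div_pow, ← mul_div_assoc, ← Finset.sum_div]
  field_simp

theorem tendsto_zero_of_norm_le_one (hc : ∀ j : ℕ, (c j : ℂ) = -(∑ i, (ε i : ℂ) * ξ i ^ j) / j)
    (hξ : ∀ i, ‖ξ i‖ ≤ 1) : Tendsto c atTop (𝓝 0) := by
  rw [tendsto_zero_iff_norm_tendsto_zero]
  have h : Tendsto (fun j : ℕ => (∑ i, ‖(ε i : ℂ)‖) / (j : ℝ)) atTop (𝓝 0) :=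
    tendsto_const_div_atTop_nhds_zero_nat _
  refine squeeze_zero (fun _ => norm_nonneg _) (fun j => ?_) h
  rw [← Complex.norm_real, hc, norm_div, norm_neg, Complex.norm_natCast]
  gcongr
  refine (norm_sum_le _ _).trans (Finset.sum_le_sum fun i _ => ?_)
  rw [norm_mul, norm_pow]
  exact mul_le_of_le_one_right (norm_nonneg _) (pow_le_one₀ (norm_nonneg _) (hξ i))

theorem tendsto_sum_log (hc : ∀ j : ℕ, (c j : ℂ) = -(∑ i, (ε i : ℂ) * ξ i ^ j) / j)
    (hξ : ∀ i, ‖ξ i‖ ≤ 1) (h1 : ∀ i, ξ i ≠ 1) {ρ : ℝ}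
    (hprod : (ρ : ℂ) = ∏ i, (1 - ξ i) ^ ε i) :
    Tendsto (fun N : ℕ => ∑ j ∈ Finset.range N, c j) atTop (𝓝 (Real.log ρ)) := by
  have h2 : Tendsto (fun N : ℕ => ((∑ j ∈ Finset.range N, c j : ℝ) : ℂ)) atTop
      (𝓝 (∑ i, (ε i : ℂ) * Complex.log (1 - ξ i))) := by
    have h3 := tendsto_finsetSum Finset.univ fun i _ =>
      (tendsto_sum_pow_div (hξ i) (h1 i)).const_mul (-(ε i : ℂ))
    simp only [neg_mul_neg] at h3
    refine h3.congr fun N => ?_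
    push_cast
    simp only [Finset.mul_sum]
    rw [Finset.sum_comm]
    refine Finset.sum_congr rfl fun j _ => ?_
    rw [hc, ← Finset.sum_neg_distrib, Finset.sum_div]
    exact Finset.sum_congr rfl fun i _ => by ring
  set S := ∑ i, (ε i : ℂ) * Complex.log (1 - ξ i) with hS
  have hre : Tendsto (fun N : ℕ => ∑ j ∈ Finset.range N, c j) atTop (𝓝 S.re) := by
    simpa only [Function.comp_def, Complex.ofReal_re] using (Complex.continuous_re.tendsto S).comp h2
  -- No branch of the complex logarithm has to be tracked: `S` is real as a limit of real numbers,
  -- and `exp S = ρ` then determines it.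
  have hSre : ((S.re : ℝ) : ℂ) = S :=
    tendsto_nhds_unique ((Complex.continuous_ofReal.tendsto _).comp hre) h2
  have hexp : Complex.exp S = ρ := by
    rw [hS, Complex.exp_sum, hprod]
    refine Finset.prod_congr rfl fun i _ => ?_
    rw [Complex.exp_int_mul, Complex.exp_log (sub_ne_zero.2 (h1 i).symm)]
  have h4 : Real.exp S.re = ρ := by
    rw [← hSre] at hexp
    exact_mod_cast hexp
  rwa [← h4, Real.log_exp]

theorem not_tendsto_of_one_lt_norm
    (hc : ∀ j : ℕ, (c j : ℂ) = -(∑ i, (ε i : ℂ) * ξ i ^ j) / j)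
    (hinj : Function.Injective ξ) (hε : ε 0 ≠ 0) (hξ : 1 < ‖ξ 0‖) (l : ℝ) :
    ¬ Tendsto c atTop (𝓝 l) := by
  intro h
  have h0 : ξ 0 ≠ 0 := norm_pos_iff.1 (one_pos.trans hξ)
  -- If `c` converged, its product with this null sequence would tend to 0; but that product is a
  -- power sum in `ξ_i / ξ_0`, one of whose bases is 1.
  have h1 : Tendsto (fun j : ℕ => (j : ℂ) / ξ 0 ^ j) atTop (𝓝 0) := by
    rw [tendsto_zero_iff_norm_tendsto_zero]
    have h2 : |‖ξ 0‖⁻¹| < 1 := by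
      rw [abs_of_nonneg (by positivity)]
      exact inv_lt_one_of_one_lt₀ hξ
    refine (tendsto_self_mul_const_pow_of_abs_lt_one h2).congr fun j => ?_
    rw [norm_div, norm_pow, Complex.norm_natCast, inv_pow, div_eq_mul_inv]
  have h3 := (((Complex.continuous_ofReal.tendsto l).comp h).mul h1)
  rw [mul_zero] at h3
  refine not_tendsto_powerSum (z := fun i => ξ i / ξ 0) (e := fun i => -(ε i : ℂ))
    (fun i j hij => hinj ((div_left_inj' h0).1 hij)) (k := 0) (div_self h0) ?_ (h3.congr' ?_)
  · simpa using hε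
  · filter_upwards [eventually_ne_atTop 0] with j hj
    exact mul_div_pow_eq hc hj

theorem exists_real_isEquivalent
    (hc : ∀ j : ℕ, (c j : ℂ) = -(∑ i, (ε i : ℂ) * ξ i ^ j) / j)
    (hε : ε 0 ≠ 0) (h0 : ξ 0 ≠ 0) (hdom : ∀ i, i ≠ 0 → ‖ξ i‖ < ‖ξ 0‖) :
    ∃ a : ℝ, ξ 0 = a ∧ c ~[atTop] fun j : ℕ => -(ε 0 : ℝ) * a ^ j / (j : ℝ) := by
  have hεC : -(ε 0 : ℂ) ≠ 0 := by simpa using hε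
  have h1 : Tendsto (fun j : ℕ => (c j : ℂ) * (j / ξ 0 ^ j)) atTop (𝓝 (-(ε 0 : ℂ))) := by
    have h2 := tendsto_powerSum (z := fun i => ξ i / ξ 0) (e := fun i => -(ε i : ℂ)) (k := 0)
      (div_self h0) fun i hi => by
        rw [norm_div, div_lt_one (norm_pos_iff.2 h0)]
        exact hdom i hi
    refine h2.congr' ?_
    filter_upwards [eventually_ne_atTop 0] with j hj
    exact (mul_div_pow_eq hc hj).symm
  -- Since `c` is real, conjugation gives the same limit with the conjugate of `ξ_0`. Dividing the
  -- two limits yields `(ξ_0 / conj ξ_0)^j → 1`, which forces `ξ_0` to be real.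
  have h2 : Tendsto (fun j : ℕ => (c j : ℂ) * (j / (starRingEnd ℂ (ξ 0)) ^ j)) atTop
      (𝓝 (-(ε 0 : ℂ))) := by
    have h3 := (Complex.continuous_conj.tendsto _).comp h1
    simpa [Function.comp_def] using h3
  have hconj : starRingEnd ℂ (ξ 0) ≠ 0 := by simpa using h0
  have hne : ∀ᶠ j : ℕ in atTop, (c j : ℂ) * (j / ξ 0 ^ j) ≠ 0 := h1.eventually_ne hεC
  have h3 : Tendsto (fun j : ℕ => (ξ 0 / starRingEnd ℂ (ξ 0)) ^ j) atTop (𝓝 1) := by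
    have h4 := h2.div h1 hεC
    rw [div_self hεC] at h4
    refine h4.congr' ?_
    filter_upwards [hne] with j hj
    have h5 : (c j : ℂ) ≠ 0 := left_ne_zero_of_mul hj
    have h6 : (j : ℂ) ≠ 0 := fun h => hj (by rw [h]; simp)
    simp only [Pi.div_apply]
    rw [div_pow]
    field_simp
  have h4 : starRingEnd ℂ (ξ 0) = ξ 0 :=
    ((div_eq_one_iff_eq hconj).1 (eq_one_of_tendsto_pow h3)).symm
  obtain ⟨a, ha⟩ := Complex.conj_eq_iff_real.1 h4
  refine ⟨a, ha, isEquivalent_of_tendsto_one ?_⟩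
  rw [ha] at h1
  have h5 : Tendsto (fun j : ℕ => c j * (j / a ^ j)) atTop (𝓝 (-(ε 0 : ℝ))) := by
    have h6 := (Complex.continuous_re.tendsto _).comp h1
    have h7 : ∀ j : ℕ, ((c j : ℂ) * (j / (a : ℂ) ^ j)).re = c j * (j / a ^ j) := fun j => by
      rw [← Complex.ofReal_natCast, ← Complex.ofReal_pow, ← Complex.ofReal_div,
        ← Complex.ofReal_mul, Complex.ofReal_re]
    simpa [Function.comp_def, h7] using h6
  have hεR : -(ε 0 : ℝ) ≠ 0 := by simpa using hε
  have h6 := h5.div_const (-(ε 0 : ℝ))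
  rw [div_self hεR] at h6
  refine h6.congr fun j => ?_
  rw [Pi.div_apply, div_div_eq_mul_div, ← mul_div_assoc, div_div, mul_comm (a ^ j)]

end Coefficients

end PascalTwo

theorem mainTheorem8 :
    -- for each `j` there is exactly one polynomial `P_j`
    (∀ j : ℕ, ∃! Q : MvPolynomial PascalTwo.AdmissibleWord ℚ, PascalTwo.Represents j Q) ∧
    ∀ (P : ℕ → MvPolynomial PascalTwo.AdmissibleWord ℚ),
      (∀ j : ℕ, PascalTwo.Represents j (P j)) →
    ∀ w : PascalTwo.AdmissibleWord,
      -- the factorization exists and has at least one factor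
      (∃ (L : ℕ) (ξ : Fin (L + 1) → ℂ) (ε : Fin (L + 1) → ℤ),
        PascalTwo.IsFactorization w.1 ξ ε) ∧
      ∀ (L : ℕ) (ξ : Fin (L + 1) → ℂ) (ε : Fin (L + 1) → ℤ),
        PascalTwo.IsFactorization w.1 ξ ε →
        -- (a) convergence; the series may converge only conditionally
        (‖ξ 0‖ ≤ 1 →
          Tendsto (fun j : ℕ => PascalTwo.coeffX w (P j)) atTop (𝓝 0) ∧
          0 < (PascalTwo.r ℝ w.1).eval (RingHom.id ℝ) 1 ∧
          Tendsto (fun N : ℕ => ∑ j ∈ Finset.range N, PascalTwo.coeffX w (P j)) atTop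
            (𝓝 (Real.log ((PascalTwo.r ℝ w.1).eval (RingHom.id ℝ) 1)))) ∧
        -- (b) divergence, with the asymptotics for a unique dominant singularity
        (1 < ‖ξ 0‖ →
          (¬ ∃ l : ℝ, Tendsto (fun j : ℕ => PascalTwo.coeffX w (P j)) atTop (𝓝 l)) ∧
          ((∀ i, i ≠ 0 → ‖ξ i‖ < ‖ξ 0‖) →
            ∃ a : ℝ, ξ 0 = (a : ℂ) ∧ a ≤ -1 ∧
              (fun j : ℕ => PascalTwo.coeffX w (P j)) ~[atTop]
                (fun j : ℕ => -(ε 0 : ℝ) * a ^ j / (j : ℝ)))) := by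
  refine ⟨fun j => ⟨PascalTwo.quotientPoly j, PascalTwo.quotientPoly_represents j,
    fun Q hQ => hQ.unique (PascalTwo.quotientPoly_represents j)⟩, fun P hP w =>
    ⟨PascalTwo.exists_isFactorization w, fun L ξ ε h => ?_⟩⟩
  have hc := h.coeffX_eq hP
  refine ⟨fun h1 => ?_, fun h1 => ⟨?_, fun hdom => ?_⟩⟩
  · have hξ : ∀ i, ‖ξ i‖ ≤ 1 := fun i => (h.antitone_norm (Fin.zero_le i)).trans h1
    have hpos : 0 < (PascalTwo.r ℝ w.1).eval (RingHom.id ℝ) 1 := by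
      rw [PascalTwo.eval_r_one]
      exact div_pos (PascalTwo.eval_numP_pos one_pos w) (PascalTwo.eval_denP_pos one_pos w)
    refine ⟨PascalTwo.tendsto_zero_of_norm_le_one hc hξ, hpos,
      PascalTwo.tendsto_sum_log hc hξ (fun i => ?_) ?_⟩
    · simpa using h.mul_ne_one one_pos i
    · rw [PascalTwo.eval_r_one, h.eval_one]
  · rintro ⟨l, hl⟩
    exact PascalTwo.not_tendsto_of_one_lt_norm hc h.injective (h.exponent_ne_zero 0) h1 l hl
  · obtain ⟨a, ha, heq⟩ := PascalTwo.exists_real_isEquivalent hc (h.exponent_ne_zero 0)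
      (h.base_ne_zero 0) hdom
    refine ⟨a, ha, ?_, heq⟩
    rw [ha, Complex.norm_real, Real.norm_eq_abs] at h1
    -- The case `a > 1` would put a zero or pole of `r_w` at the positive real `1/a`.
    rcases lt_abs.1 h1 with h2 | h2
    · refine absurd ?_ (h.mul_ne_one (inv_pos.2 (one_pos.trans h2)) 0)
      rw [ha, ← Complex.ofReal_mul, mul_inv_cancel₀ (one_pos.trans h2).ne', Complex.ofReal_one]
    · linarith
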